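/- Let $p(y\,|\,x_1,x_2)$ be a discrete memoryless multiple access channel (DM-MAC) with input alphabets $\mathcal X_1,\mathcal X_2$ and finite output alphabet $\mathcal Y$, let $\mathbb F_q$ be a finite field of order $q$, let $\varphi_j:\mathbb F_q\to\mathcal X_j$ ($j=1,2$) be symbol maps, and let $p(y\,|\,u_1,u_2)=p(y\,|\,x_1=\varphi_1(u_1),\,x_2=\varphi_2(u_2))$ be the resulting virtual channel. Let $U_1,U_2$ be independent and uniform on $\mathbb F_q$, and let $Y$ be the output of the virtual channel with inputs $U_1,U_2$; information measures are to the base $q$. Let $\mathcal R_{\mathrm{MAC}}(U_1,U_2)$ be the set of pairs $(R_1,R_2)$ with $R_1<I(U_1;Y|U_2)$, $R_2<I(U_2;Y|U_1)$ and $R_1+R_2<I(U_1,U_2;Y)$, and let $\mathcal R_{\mathrm L}(U_1,U_2)$ be the set of pairs with $\min(R_1,R_2)<\max\{I(U_1;Y),I(U_2;Y)\}$. For $k_j=\lceil nR_j\rceil$ and $\kappa=\max(k_1,k_2)$, a pair of coset codes of length $n$ with the same generator matrix $G\in\mathbb F_q^{\kappa\times n}$ and coset leaders $d_1,d_2\in\mathbb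 F_q^n$ assigns to the message $m_j\in\mathbb F_q^{k_j}$ the codeword $u_j^n(m_j)=[m_j\ \mathbf 0_{\kappa-k_j}]\,G+d_j$, and sender $j$ transmits $\varphi_j(u_j^n(m_j))$ (symbol by symbol). For independent uniform messages and a decoder that knows the codes, $P_e^{(n)}$ is the probability that $(m_1,m_2)$ is not recovered. The pair $(R_1,R_2)$, $R_1,R_2\ge 0$, is achievable by random coset codes in $\mathbb F_q$ with the same generator matrix if, for suitable decoders, $\lim_{n\to\infty}\mathbb E[P_e^{(n)}]=0$ when all entries of $G,D_1,D_2$ are i.i.d. uniform on $\mathbb F_q$; it is achievable by random linear codes with the same generator matrix if this holds with $D_1=D_2=\mathbf 0$ and $G$ with i.i.d. uniform entries. **Proposition.** Let $(R_1,R_2)\in\mathcal R_{\mathrm{MAC}}(U_1,U_2)\cap\mathcal R_{\mathrm L}(U_1,U_2)$ with $R_1,R_2\ge 0$. Then $(R_1,R_2)$ is achievable for the DM-MAC $p(y\,|\,x_1,x_2)$ (with the symbol maps $\varphi_1,\varphi_2$) by random coset codes in $\mathbb F_q$ with the same generator matrix. Moreover, $(R_1,R_2)$ is also achievable by random linear codes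 with the same generator matrix, provided that $R_1,R_2>0$ and that there is no $(a,b,c,d)\in\mathbb F_q^4$ with $(a,b,c,d)\ne(1,0,0,1)$, with $b=0$ if $R_1<R_2$, with $c=0$ if $R_2<R_1$, and with $p(\cdot\,|\,au_1+bu_2,\;cu_1+du_2)=p(\cdot\,|\,u_1,u_2)$ for all $u_1,u_2\in\mathbb F_q$. -/

import Mathlib

open scoped BigOperators Topology

/-! ### Information measures of finitely supported random variables -/

open Classical in
/-- The pmf of the random variable `X` when the outcome `ω` has probability `P ω`. -/
noncomputable def law {Ω A : Type*} [Fintype Ω] (P : Ω → ℝ) (X : Ω → A) (a : A) : ℝ :=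
  ∑ ω, if X ω = a then P ω else 0

/-- Shannon entropy `H(X)`, logarithms to the base `b`. -/
noncomputable def entropy {Ω A : Type*} [Fintype Ω] [Fintype A]
    (b : ℝ) (P : Ω → ℝ) (X : Ω → A) : ℝ :=
  -∑ a, law P X a * Real.logb b (law P X a)

/-- Mutual information `I(X; Z) = H(X) + H(Z) - H(X, Z)`. -/
noncomputable def mutualInfo {Ω A B : Type*} [Fintype Ω] [Fintype A] [Fintype B]
    (b : ℝ) (P : Ω → ℝ) (X : Ω → A) (Z : Ω → B) : ℝ :=
  entropy b P X + entropy b P Z - entropy b P (fun ω => (X ω, Z ω))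

/-- Conditional mutual information
`I(X; Z | T) = H(X, T) + H(Z, T) - H(X, Z, T) - H(T)`. -/
noncomputable def condMutualInfo {Ω A B C : Type*} [Fintype Ω] [Fintype A] [Fintype B] [Fintype C]
    (b : ℝ) (P : Ω → ℝ) (X : Ω → A) (Z : Ω → B) (T : Ω → C) : ℝ :=
  entropy b P (fun ω => (X ω, T ω)) + entropy b P (fun ω => (Z ω, T ω))
    - entropy b P (fun ω => (X ω, Z ω, T ω)) - entropy b P T

/-! ### The virtual channel and the rate regions -/

/-- A channel with two inputs is a family of pmfs `W x₁ x₂ = p(· | x₁, x₂)`. This is the virtual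
channel `p(y | u₁, u₂) = W (y | φ₁ u₁, φ₂ u₂)`. -/
def virtualChannel {F X₁ X₂ Y : Type*} (W : X₁ → X₂ → PMF Y) (φ₁ : F → X₁) (φ₂ : F → X₂) :
    F → F → PMF Y :=
  fun u₁ u₂ => W (φ₁ u₁) (φ₂ u₂)

/-- The joint pmf of `(U₁, U₂, Y)`: `U₁`, `U₂` are independent and uniform on `F`, and `Y` is the
output of the channel `V` with inputs `U₁`, `U₂`. -/
noncomputable def uniformInputPmf {F Y : Type*} [Fintype F] (V : F → F → PMF Y) :
    F × F × Y → ℝ :=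
  fun ω => (1 / (Fintype.card F : ℝ)) * (1 / (Fintype.card F : ℝ)) * (V ω.1 ω.2.1 ω.2.2).toReal

/-- The pentagon `R₁ < I(U₁; Y | U₂)`, `R₂ < I(U₂; Y | U₁)`, `R₁ + R₂ < I(U₁, U₂; Y)` for
independent uniform inputs; logarithms to the base `q = |F|`. -/
def regionMAC {F Y : Type*} [Fintype F] [Fintype Y] (V : F → F → PMF Y) : Set (ℝ × ℝ) :=
  {R | R.1 < condMutualInfo (Fintype.card F) (uniformInputPmf V)
        (fun ω => ω.1) (fun ω => ω.2.2) (fun ω => ω.2.1) ∧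
      R.2 < condMutualInfo (Fintype.card F) (uniformInputPmf V)
        (fun ω => ω.2.1) (fun ω => ω.2.2) (fun ω => ω.1) ∧
      R.1 + R.2 < mutualInfo (Fintype.card F) (uniformInputPmf V)
        (fun ω => (ω.1, ω.2.1)) (fun ω => ω.2.2)}

/-- The region `min (R₁, R₂) < max (I(U₁; Y), I(U₂; Y))` for independent uniform inputs. -/
def regionL {F Y : Type*} [Fintype F] [Fintype Y] (V : F → F → PMF Y) : Set (ℝ × ℝ) :=
  {R | min R.1 R.2 <
      max (mutualInfo (Fintype.card F) (uniformInputPmf V) (fun ω => ω.1) (fun ω => ω.2.2))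
        (mutualInfo (Fintype.card F) (uniformInputPmf V) (fun ω => ω.2.1) (fun ω => ω.2.2))}

/-! ### Codes -/

/-- Probability of the output sequence `y` when `x₁`, `x₂` are sent over the memoryless
channel `W`. -/
noncomputable def blockProb {X₁ X₂ Y : Type*} (W : X₁ → X₂ → PMF Y) {n : ℕ}
    (x₁ : Fin n → X₁) (x₂ : Fin n → X₂) (y : Fin n → Y) : ℝ :=
  ∏ i, (W (x₁ i) (x₂ i) (y i)).toReal

open Classical in
/-- Average probability of error `P((M̂₁, M̂₂) ≠ (M₁, M₂))` of a block code for the channel `W` with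
encoders `e₁`, `e₂` and decoder `dec`, for independent uniform messages. -/
noncomputable def avgError {X₁ X₂ Y M₁ M₂ : Type*} [Fintype Y] [Fintype M₁] [Fintype M₂]
    (W : X₁ → X₂ → PMF Y) {n : ℕ} (e₁ : M₁ → Fin n → X₁) (e₂ : M₂ → Fin n → X₂)
    (dec : (Fin n → Y) → M₁ × M₂) : ℝ :=
  𝔼 m₁ : M₁, 𝔼 m₂ : M₂,
    ∑ y : Fin n → Y, if dec y = (m₁, m₂) then 0 else blockProb W (e₁ m₁) (e₂ m₂) y

/-- `[m 0]`: the vector `m` of length `k`, padded by zeros to the length `κ ≥ k`. -/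
def zeroPad {F : Type*} [Zero F] {k : ℕ} (κ : ℕ) (m : Fin k → F) : Fin κ → F :=
  fun i => if h : i.1 < k then m ⟨i.1, h⟩ else 0

/-- The codeword `[m 0] G + d` of the coset code with generator matrix `G` and coset leader
(dithering vector) `d`; the code is linear when `d = 0`. -/
def codeword {F : Type*} [Field F] {k κ n : ℕ} (G : Matrix (Fin κ) (Fin n) F) (d : Fin n → F)
    (m : Fin k → F) : Fin n → F :=
  Matrix.vecMul (zeroPad κ m) G + d

/-- Average probability of error for the channel `W` of the pair of coset codes with the common
generator matrix `G` and the coset leaders `d₁`, `d₂`, with message sets `F ^ k₁` and `F ^ k₂`, when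
the code symbols are mapped to channel inputs by `φ₁`, `φ₂`, and with decoder `dec`. -/
noncomputable def cosetError {F X₁ X₂ Y : Type*} [Field F] [Fintype F] [Fintype Y]
    (W : X₁ → X₂ → PMF Y) (φ₁ : F → X₁) (φ₂ : F → X₂) {k₁ k₂ n : ℕ}
    (G : Matrix (Fin (max k₁ k₂)) (Fin n) F) (d₁ d₂ : Fin n → F)
    (dec : (Fin n → Y) → (Fin k₁ → F) × (Fin k₂ → F)) : ℝ :=
  avgError W (fun (m : Fin k₁ → F) i => φ₁ (codeword G d₁ m i))
    (fun (m : Fin k₂ → F) i => φ₂ (codeword G d₂ m i)) dec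

/-- The rate pair `(R₁, R₂)` is achievable for `W`, with symbol maps `φ₁`, `φ₂`, by random coset
codes with the same generator matrix: for message lengths `⌈n R₁⌉`, `⌈n R₂⌉` and suitable decoders
(which know the codes), the expected average probability of error tends to `0`, where all the
entries of `G`, `D₁`, `D₂` are i.i.d. uniform on `F`, i.e. `(G, D₁, D₂)` is uniformly distributed. -/
def AchievableByRandomCosetCodes {F X₁ X₂ Y : Type*} [Field F] [Fintype F] [Fintype Y]
    (W : X₁ → X₂ → PMF Y) (φ₁ : F → X₁) (φ₂ : F → X₂) (R₁ R₂ : ℝ) : Prop :=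
  ∃ dec : ∀ n : ℕ, Matrix (Fin (max ⌈n * R₁⌉₊ ⌈n * R₂⌉₊)) (Fin n) F → (Fin n → F) → (Fin n → F) →
      (Fin n → Y) → (Fin ⌈n * R₁⌉₊ → F) × (Fin ⌈n * R₂⌉₊ → F),
    Filter.Tendsto
      (fun n : ℕ => 𝔼 G : Matrix (Fin (max ⌈n * R₁⌉₊ ⌈n * R₂⌉₊)) (Fin n) F,
        𝔼 d₁ : Fin n → F, 𝔼 d₂ : Fin n → F, cosetError W φ₁ φ₂ G d₁ d₂ (dec n G d₁ d₂))
      Filter.atTop (𝓝 0)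

/-- The same for random linear codes with the same generator matrix: both coset leaders are zero,
and only `G` is random. -/
def AchievableByRandomLinearCodes {F X₁ X₂ Y : Type*} [Field F] [Fintype F] [Fintype Y]
    (W : X₁ → X₂ → PMF Y) (φ₁ : F → X₁) (φ₂ : F → X₂) (R₁ R₂ : ℝ) : Prop :=
  ∃ dec : ∀ n : ℕ, Matrix (Fin (max ⌈n * R₁⌉₊ ⌈n * R₂⌉₊)) (Fin n) F →
      (Fin n → Y) → (Fin ⌈n * R₁⌉₊ → F) × (Fin ⌈n * R₂⌉₊ → F),
    Filter.Tendsto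
      (fun n : ℕ => 𝔼 G : Matrix (Fin (max ⌈n * R₁⌉₊ ⌈n * R₂⌉₊)) (Fin n) F,
        cosetError W φ₁ φ₂ G 0 0 (dec n G))
      Filter.atTop (𝓝 0)

/-- Two message pairs of linear codes with the same generator matrix cannot be told apart if the
code symbols of the second arise from those of the first by a linear map that leaves the channel
`V` unchanged. This says that there is such a map
`(u₁, u₂) ↦ (a u₁ + b u₂, c u₁ + d u₂)` other than the identity; a sender with the lower rate cannot
realize a contribution of the longer message of the other, so `b` (or `c`) is then zero. -/
def HasLinearAmbiguity {F Y : Type*} [Field F] (V : F → F → PMF Y) (R₁ R₂ : ℝ) : Prop :=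
  ∃ a b c d : F, ¬ (a = 1 ∧ b = 0 ∧ c = 0 ∧ d = 1) ∧ (R₁ < R₂ → b = 0) ∧ (R₂ < R₁ → c = 0) ∧
    ∀ u₁ u₂ : F, V (a * u₁ + b * u₂) (c * u₁ + d * u₂) = V u₁ u₂

/-! Each pair of code letters is the image of a uniformly random column `g` under a linear map `φ m
: V → U`, with `U = F × F` in the application. If `φ m` is onto, the sent letter is uniform. Given
the sent letter, the letter of a competitor `m'` is uniform on a coset of `L = φ m' (ker φ m)`, so
competitors are classified by the subspace `L`.

The decoder maximizes the likelihood among the messages whose likelihood is, for every `L ≠ ⊥`, at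
least `T L` times that under the channel averaged over cosets of `L`. The true message misses a
threshold with exponentially small probability if `T L = q ^ (n τ)` with `τ < I(U; Y | U + L)`
(Chernoff, `exists_chernoff_lt_one`). A competitor of type `L` has expected likelihood ratio at most
one (`expect_likelihoodRatio_le_one`), so these competitors together cost at most their number
divided by `T L`. Hence the growth rate of their number must lie below `I(U; Y | U + L)`.

That rate is `R₁ + R₂` for the whole plane, `R₁` or `R₂` for the axes and `min R₁ R₂` for the other
lines (`ncard_competitors_le_rpow`). The pentagon settles the plane and the axes. An oblique line is
complementary to both axes, and superadditivity of information over complementary cosets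
(`cosetInfo_top_le_add`) gives `I(U; Y | U + L) ≥ max (I(U₁; Y), I(U₂; Y))`.

Type `⊥` remains, where the competing letters are a fixed linear function `A` of the sent ones. For
coset codes the leaders exclude this. For linear codes the absence of ambiguity makes `A` change the
channel, and the Bhattacharyya bound applies. The message pairs to which this does not apply form a
vanishing fraction if both rates are positive. -/

/-! ### Averages over subspaces -/

section SubspaceAverage

variable {F V H : Type*} [Field F] [AddCommGroup V] [Module F V] [Fintype V]
  [AddCommGroup H] [Module F H] [Fintype H]

open Classical in
/-- The average of `h` over the subspace `K`. -/
noncomputable def subspaceAvg (K : Submodule F V) (h : V → ℝ) : ℝ := 𝔼 k : K, h k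

theorem subspaceAvg_shift {K : Submodule F V} {k : V} (hk : k ∈ K) (h : V → ℝ) :
    subspaceAvg K (fun v => h (v + k)) = subspaceAvg K h := by
  classical
  exact Fintype.expect_equiv (Equiv.addRight (⟨k, hk⟩ : K)) _ _ fun i => rfl

theorem subspaceAvg_const (K : Submodule F V) (a : ℝ) : subspaceAvg K (fun _ => a) = a := by
  classical
  exact Fintype.expect_const a

theorem subspaceAvg_congr {K : Submodule F V} {h h' : V → ℝ} (hh : ∀ k ∈ K, h k = h' k) :
    subspaceAvg K h = subspaceAvg K h' := by
  classical
  exact Finset.expect_congr rfl fun k _ => hh k k.2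

theorem subspaceAvg_top (h : V → ℝ) : subspaceAvg (⊤ : Submodule F V) h = 𝔼 v, h v := by
  classical
  exact Fintype.expect_equiv (Submodule.topEquiv (R := F) (M := V)).toEquiv (fun k => h k) h
    fun _ => rfl

theorem subspaceAvg_nonneg {K : Submodule F V} {h : V → ℝ} (hh : ∀ v, 0 ≤ h v) :
    0 ≤ subspaceAvg K h := by
  classical
  exact Finset.expect_nonneg fun k _ => hh k

theorem subspaceAvg_pos {K : Submodule F V} {h : V → ℝ} (hh : ∀ v, 0 ≤ h v) (h0 : 0 < h 0) :
    0 < subspaceAvg K h := by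
  classical
  exact Finset.expect_pos' (fun k _ => hh k) ⟨0, Finset.mem_univ _, h0⟩

theorem mul_subspaceAvg (K : Submodule F V) (a : ℝ) (h : V → ℝ) :
    a * subspaceAvg K h = subspaceAvg K (fun v => a * h v) := by
  classical
  exact Finset.mul_expect _ _ _

theorem subspaceAvg_comm {ι : Type*} (s : Finset ι) (K : Submodule F V) (h : ι → V → ℝ) :
    𝔼 i ∈ s, subspaceAvg K (h i) = subspaceAvg K (fun v => 𝔼 i ∈ s, h i v) := by
  classical
  exact Finset.expect_comm _ _ _

/-- A linear map sends the uniform distribution on a subspace to the uniform distribution on its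
image. -/
theorem subspaceAvg_map (K : Submodule F V) (f : V →ₗ[F] H) (h : H → ℝ) :
    subspaceAvg (K.map f) h = subspaceAvg K (fun v => h (f v)) := by
  classical
  -- Average over the image and over `K` at once: shifting by `f v` does not change the average over
  -- the image, and shifting by a preimage of `w` does not change the average over `K`.
  calc subspaceAvg (K.map f) h
      = subspaceAvg K (fun v => subspaceAvg (K.map f) (fun w => h (w + f v))) := by
        rw [← subspaceAvg_const K (subspaceAvg (K.map f) h)]
        exact subspaceAvg_congr fun k hk =>
          (subspaceAvg_shift (Submodule.mem_map_of_mem hk) h).symm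
    _ = subspaceAvg (K.map f) (fun w => subspaceAvg K (fun v => h (w + f v))) :=
        Finset.expect_comm _ _ _
    _ = subspaceAvg (K.map f) (fun _ => subspaceAvg K (fun v => h (f v))) := by
        refine subspaceAvg_congr fun w hw => ?_
        obtain ⟨k, hk, rfl⟩ := Submodule.mem_map.1 hw
        refine (subspaceAvg_congr fun v _ => ?_).trans (subspaceAvg_shift hk fun v => h (f v))
        rw [map_add, add_comm]
    _ = _ := subspaceAvg_const _ _

theorem expect_comp_of_surjective {f : V →ₗ[F] H} (hf : Function.Surjective f) (h : H → ℝ) :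
    𝔼 v, h (f v) = 𝔼 u, h u := by
  rw [← subspaceAvg_top (F := F), ← subspaceAvg_top (F := F), ← LinearMap.range_eq_top.2 hf,
    LinearMap.range_eq_map, subspaceAvg_map]

theorem expect_shift (k : V) (h : V → ℝ) : 𝔼 v, h (v + k) = 𝔼 v, h v :=
  Fintype.expect_equiv (Equiv.addRight k) _ _ fun _ => rfl

theorem expect_subspaceAvg (K : Submodule F V) (h : V → ℝ) :
    𝔼 v, subspaceAvg K (fun k => h (v + k)) = 𝔼 v, h v := by
  rw [subspaceAvg_comm]
  simp only [expect_shift, subspaceAvg_const]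

end SubspaceAverage

/-! ### Channels with inputs in a vector space -/

section Channel

variable {F U V Y : Type*} [Field F] [AddCommGroup U] [Module F U] [Fintype U]
  [AddCommGroup V] [Module F V] [Fintype V]

/-- The channel `p` averaged over the coset `u + L` of its input `u`. -/
noncomputable def cosetChannel (p : U → Y → ℝ) (L : Submodule F U) (u : U) (y : Y) : ℝ :=
  subspaceAvg L fun v => p (u + v) y

variable {p : U → Y → ℝ}

theorem cosetChannel_add (L : Submodule F U) (u : U) {v : U} (hv : v ∈ L) (y : Y) :
    cosetChannel p L (u + v) y = cosetChannel p L u y := by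
  unfold cosetChannel
  rw [← subspaceAvg_shift hv fun w => p (u + w) y]
  simp only [add_assoc, add_comm v]

theorem cosetChannel_nonneg (hp : ∀ u y, 0 ≤ p u y) (L : Submodule F U) (u : U) (y : Y) :
    0 ≤ cosetChannel p L u y := subspaceAvg_nonneg fun _ => hp _ _

theorem cosetChannel_pos (hp : ∀ u y, 0 ≤ p u y) (L : Submodule F U) {u : U} {y : Y}
    (h : 0 < p u y) : 0 < cosetChannel p L u y :=
  subspaceAvg_pos (fun _ => hp _ _) (by simpa using h)

theorem cosetChannel_top (u : U) (y : Y) :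
    cosetChannel p (⊤ : Submodule F U) u y = 𝔼 v, p v y := by
  unfold cosetChannel
  rw [subspaceAvg_top, ← expect_shift u fun v => p v y]
  simp only [add_comm]

/-- A competing codeword letter, which is uniform on a coset of `L` given the sent letter, has
expected likelihood ratio at most one. -/
theorem expect_likelihoodRatio_le_one [Fintype Y] (hp0 : ∀ u y, 0 ≤ p u y) (hp1 : ∀ u, ∑ y, p u y = 1)
    (f f' : V →ₗ[F] U) :
    𝔼 g, ∑ y, p (f g) y * (p (f' g) y / cosetChannel p ((LinearMap.ker f).map f') (f' g) y) ≤ 1 := by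
  set L := (LinearMap.ker f).map f'
  have key : ∀ y, 𝔼 g, p (f g) y * (p (f' g) y / cosetChannel p L (f' g) y)
      ≤ 𝔼 g, p (f g) y := by
    intro y
    -- Average first over the cosets of `ker f`. There the sent letter and the denominator are
    -- constant, while the numerator averages to exactly that denominator. The quotient is 1, or 0
    -- where the denominator vanishes.
    rw [← expect_subspaceAvg (LinearMap.ker f)]
    refine Finset.expect_le_expect fun g _ => ?_
    have : subspaceAvg (LinearMap.ker f) (fun k => p (f (g + k)) y *
        (p (f' (g + k)) y / cosetChannel p L (f' (g + k)) y))
        = p (f g) y * (cosetChannel p L (f' g) y / cosetChannel p L (f' g) y) := by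
      have h1 : cosetChannel p L (f' g) y / cosetChannel p L (f' g) y =
          (cosetChannel p L (f' g) y)⁻¹ *
            subspaceAvg (LinearMap.ker f) (fun k => p (f' g + f' k) y) := by
        rw [← subspaceAvg_map (LinearMap.ker f) f' fun v => p (f' g + v) y, div_eq_inv_mul]
        rfl
      rw [h1, ← mul_assoc, mul_subspaceAvg]
      refine subspaceAvg_congr fun k hk => ?_
      rw [map_add, map_add, cosetChannel_add L _ (Submodule.mem_map_of_mem hk),
        LinearMap.mem_ker.1 hk, add_zero, mul_assoc, div_eq_inv_mul]
    rw [this]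
    exact mul_le_of_le_one_right (hp0 _ _) (div_self_le_one _)
  calc _ = ∑ y, 𝔼 g, p (f g) y * (p (f' g) y / cosetChannel p L (f' g) y) :=
        Finset.expect_sum_comm _ _ _
    _ ≤ ∑ y, 𝔼 g, p (f g) y := Finset.sum_le_sum fun y _ => key y
    _ = 1 := by
        rw [← Finset.expect_sum_comm]
        simp only [hp1, Fintype.expect_one]

end Channel

/-- Expectations of products over the letters of a block factorize. -/
theorem expect_sum_prod {V Y : Type*} [Fintype V] [Fintype Y] (n : ℕ) (f : V → Y → ℝ) :
    𝔼 g : Fin n → V, ∑ y : Fin n → Y, ∏ i, f (g i) (y i) = (𝔼 v, ∑ y, f v y) ^ n := by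
  rw [Finset.expect_pow, Fintype.piFinset_univ]
  refine Finset.expect_congr rfl fun g _ => ?_
  rw [Finset.prod_univ_sum, Fintype.piFinset_univ]

/-! ### Error exponents -/

section Exponents

variable {F U Y : Type*} [Field F] [AddCommGroup U] [Module F U] [Fintype U] [Fintype Y]

/-- `I(U; Y | U + L)`: the information that the output of the channel `p` with uniform input `U`
gives about the input, when the coset of `L` of the input is known. -/
noncomputable def cosetInfo (b : ℝ) (p : U → Y → ℝ) (L : Submodule F U) : ℝ :=
  𝔼 u, ∑ y, p u y * Real.logb b (p u y / cosetChannel p L u y)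

theorem exists_lt_one_of_hasDerivAt {h : ℝ → ℝ} {d : ℝ} (hd : HasDerivAt h d 0) (hd0 : d < 0)
    (h0 : h 0 = 1) : ∃ s, 0 < s ∧ s < 1 ∧ h s < 1 := by
  have h1 : ∀ᶠ s in 𝓝[≠] (0 : ℝ), slope h 0 s < 0 :=
    (hasDerivAt_iff_tendsto_slope.1 hd).eventually (gt_mem_nhds hd0)
  have h2 : ∀ᶠ s in 𝓝[>] (0 : ℝ), slope h 0 s < 0 :=
    h1.filter_mono (nhdsWithin_mono _ fun x hx => ne_of_gt hx)
  have h3 : ∀ᶠ s in 𝓝[>] (0 : ℝ), s < 1 :=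
    nhdsWithin_le_nhds (gt_mem_nhds one_pos)
  obtain ⟨s, ⟨hs1, hs2⟩, hs3⟩ := ((h2.and h3).and self_mem_nhdsWithin).exists
  have hs3 : 0 < s := hs3
  refine ⟨s, hs3, hs2, ?_⟩
  rw [slope_def_field, sub_zero, h0, div_neg_iff] at hs1
  rcases hs1 with h | h <;> linarith

/-- As a function of `s` the quantity equals 1 at `s = 0`, and its derivative there is `(τ -
cosetInfo b p L) * log b`, which is negative for `τ` strictly between `R` and the information. -/
theorem exists_chernoff_lt_one {b : ℝ} (hb : 1 < b) {p : U → Y → ℝ} (hp0 : ∀ u y, 0 ≤ p u y)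
    (hp1 : ∀ u, ∑ y, p u y = 1) (L : Submodule F U) {R : ℝ} (hR : R < cosetInfo b p L) :
    ∃ τ s : ℝ, R < τ ∧ 0 < s ∧ s < 1 ∧
      b ^ (τ * s) * 𝔼 u, ∑ y, p u y ^ (1 - s) * cosetChannel p L u y ^ s < 1 := by
  obtain ⟨τ, hRτ, hτ⟩ := exists_between hR
  have hlb : 0 < Real.log b := Real.log_pos hb
  set c : U → Y → ℝ := fun u y => τ * Real.log b - Real.log (p u y / cosetChannel p L u y)
  set h : ℝ → ℝ := fun s => (∑ u, ∑ y, p u y * Real.exp (s * c u y)) / Fintype.card U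
  have hd : HasDerivAt h ((∑ u, ∑ y, p u y * c u y) / Fintype.card U) 0 := by
    refine HasDerivAt.div_const (HasDerivAt.fun_sum fun u _ => HasDerivAt.fun_sum fun y _ => ?_) _
    have := (((hasDerivAt_id (0 : ℝ)).mul_const (c u y)).exp).const_mul (p u y)
    simpa using this
  have hd0 : (∑ u, ∑ y, p u y * c u y) / Fintype.card U < 0 := by
    rw [← Fintype.expect_eq_sum_div_card]
    have : ∀ u, ∑ y, p u y * c u y = τ * Real.log b -
        Real.log b * ∑ y, p u y * Real.logb b (p u y / cosetChannel p L u y) := by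
      intro u
      rw [Finset.mul_sum, ← mul_one (τ * Real.log b), ← hp1 u, Finset.mul_sum,
        ← Finset.sum_sub_distrib]
      refine Finset.sum_congr rfl fun y _ => ?_
      rw [← Real.log_div_log]
      simp only [c]
      field_simp
    simp only [this]
    rw [Finset.expect_sub_distrib, Fintype.expect_const, ← Finset.mul_expect]
    change τ * Real.log b - Real.log b * cosetInfo b p L < 0
    nlinarith
  have h0 : h 0 = 1 := by
    simp only [h, zero_mul, Real.exp_zero, mul_one, hp1]
    simp
  obtain ⟨s, hs0, hs1, hs⟩ := exists_lt_one_of_hasDerivAt hd hd0 h0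
  refine ⟨τ, s, hRτ, hs0, hs1, lt_of_eq_of_lt ?_ hs⟩
  simp only [h]
  rw [← Fintype.expect_eq_sum_div_card, Finset.mul_expect]
  refine Finset.expect_congr rfl fun u _ => ?_
  rw [Finset.mul_sum]
  refine Finset.sum_congr rfl fun y _ => ?_
  rcases (hp0 u y).eq_or_lt with hp | hp
  -- Here `s < 1` matters: it makes the power of zero vanish.
  · rw [← hp, Real.zero_rpow (by linarith), zero_mul, zero_mul, mul_zero]
  · have hL := cosetChannel_pos hp0 L hp
    have e1 : p u y = Real.exp (Real.log (p u y)) := (Real.exp_log hp).symm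
    rw [Real.rpow_def_of_pos hp, Real.rpow_def_of_pos hL, Real.rpow_def_of_pos (by linarith)]
    conv_rhs => rw [e1]
    rw [← Real.exp_add, ← Real.exp_add, ← Real.exp_add]
    congr 1
    simp only [c, Real.log_div hp.ne' hL.ne']
    ring

end Exponents

/-- By the AM-GM inequality each term is at most the mean of `p u y` and `p (A u) y`, and these
means sum to 1 for every `u`. Equality fails wherever the two values differ. -/
theorem bhattacharyya_lt_one {U Y : Type*} [Fintype U] [Fintype Y] {p : U → Y → ℝ} (hp0 : ∀ u y, 0 ≤ p u y)
    (hp1 : ∀ u, ∑ y, p u y = 1) {A : U → U} (hA : ∃ u, p (A u) ≠ p u) :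
    𝔼 u, ∑ y, √(p u y) * √(p (A u) y) < 1 := by
  have amgm : ∀ u y, √(p u y) * √(p (A u) y) ≤ (p u y + p (A u) y) / 2 := fun u y => by
    nlinarith [Real.sq_sqrt (hp0 u y), Real.sq_sqrt (hp0 (A u) y),
      sq_nonneg (√(p u y) - √(p (A u) y))]
  have hsum : ∀ u, ∑ y, (p u y + p (A u) y) / 2 = 1 := fun u => by
    rw [← Finset.sum_div, Finset.sum_add_distrib, hp1, hp1]; norm_num
  obtain ⟨u, hu⟩ := hA
  obtain ⟨y, hy⟩ := Function.ne_iff.1 hu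
  refine Finset.expect_lt (fun v _ => ?_) ⟨u, Finset.mem_univ _, ?_⟩
  · rw [← hsum v]
    exact Finset.sum_le_sum fun y _ => amgm v y
  · rw [← hsum u]
    refine Finset.sum_lt_sum (fun y _ => amgm u y) ⟨y, Finset.mem_univ _, ?_⟩
    have : √(p u y) - √(p (A u) y) ≠ 0 := fun h => hy <| by
      rw [← Real.sq_sqrt (hp0 u y), ← Real.sq_sqrt (hp0 (A u) y), sub_eq_zero.1 h]
    nlinarith [Real.sq_sqrt (hp0 u y), Real.sq_sqrt (hp0 (A u) y), sq_pos_of_ne_zero this]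

/-! ### Decoding random linear images -/

section Decoding

variable {F U V Y M : Type*} [Field F] [AddCommGroup U] [Module F U]
  [AddCommGroup V] [Module F V]

/-- The likelihood of the message `m`, whose codeword has the letters `φ m (g i)`. -/
noncomputable def likelihood (p : U → Y → ℝ) (φ : M → V →ₗ[F] U) {n : ℕ} (g : Fin n → V)
    (y : Fin n → Y) (m : M) : ℝ := ∏ i, p (φ m (g i)) (y i)

/-- There is a maximum likelihood decoder among the messages of the set `S g y`. -/
theorem exists_argmax_decoder {α β : Type*} [Nonempty M] [Finite M] (S : α → β → Set M)
    (lik : α → β → M → ℝ) :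
    ∃ dec : α → β → M, ∀ a b, ∀ m ∈ S a b, dec a b ∈ S a b ∧ lik a b m ≤ lik a b (dec a b) := by
  have : ∀ a b, ∃ m' : M, ∀ m ∈ S a b, m' ∈ S a b ∧ lik a b m ≤ lik a b m' := by
    intro a b
    rcases (S a b).eq_empty_or_nonempty with h | h
    · exact ⟨Classical.arbitrary M, by simp [h]⟩
    · obtain ⟨m', hm', hmax⟩ := Set.exists_max_image (S a b) (lik a b) (Set.toFinite _) h
      exact ⟨m', fun m hm => ⟨hm', hmax m hm⟩⟩
  choose dec hdec using this
  exact ⟨dec, hdec⟩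

/-- The Chernoff trick: the likelihood of a sent message below its threshold is replaced by a
product of powers, which factorizes over the letters. -/
theorem le_rpow_mul_rpow {a b s : ℝ} (ha : 0 ≤ a) (hab : a ≤ b) (hs : 0 ≤ s) :
    a ≤ a ^ (1 - s) * b ^ s := by
  rcases ha.eq_or_lt with rfl | ha
  · exact mul_nonneg (Real.rpow_nonneg le_rfl _) (Real.rpow_nonneg hab _)
  · calc a = a ^ (1 - s) * a ^ s := by rw [← Real.rpow_add ha]; simp
      _ ≤ _ := by gcongr

variable {p : U → Y → ℝ}

theorem likelihood_nonneg (hp0 : ∀ u y, 0 ≤ p u y) (φ : M → V →ₗ[F] U) {n : ℕ}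
    (g : Fin n → V) (y : Fin n → Y) (m : M) : 0 ≤ likelihood p φ g y m :=
  Finset.prod_nonneg fun _ _ => hp0 _ _

variable [Fintype U] [Fintype V] [Fintype Y]

/-- The columns are independent and surjectivity makes each sent letter uniform on `U`, so the
expectation is the power of a single-letter quantity. -/
theorem expect_sum_rpow_mul_rpow (hp0 : ∀ u y, 0 ≤ p u y) {L : Submodule F U} {T s : ℝ}
    (hT : 0 ≤ T) {φ : M → V →ₗ[F] U} {m : M} (hm : Function.Surjective (φ m)) (n : ℕ) :
    𝔼 g : Fin n → V, ∑ y, likelihood p φ g y m ^ (1 - s) *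
        (T * likelihood (cosetChannel p L) φ g y m) ^ s =
      T ^ s * (𝔼 u, ∑ y, p u y ^ (1 - s) * cosetChannel p L u y ^ s) ^ n := by
  have h : ∀ (g : Fin n → V) y, likelihood p φ g y m ^ (1 - s) *
        (T * likelihood (cosetChannel p L) φ g y m) ^ s =
      T ^ s * ∏ i, (p (φ m (g i)) (y i) ^ (1 - s) * cosetChannel p L (φ m (g i)) (y i) ^ s) := by
    intro g y
    rw [Real.mul_rpow hT (likelihood_nonneg (cosetChannel_nonneg (F := F) hp0 L) φ g y m),
      Finset.prod_mul_distrib, Real.finsetProd_rpow _ _ fun i _ => hp0 _ _,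
      Real.finsetProd_rpow _ _ fun i _ => cosetChannel_nonneg hp0 L _ _]
    simp only [likelihood]
    ring
  simp only [h, ← Finset.mul_sum, ← Finset.mul_expect]
  rw [expect_sum_prod n fun v y => p (φ m v) y ^ (1 - s) * cosetChannel p L (φ m v) y ^ s,
    expect_comp_of_surjective hm fun u => ∑ y, p u y ^ (1 - s) * cosetChannel p L u y ^ s]

theorem expect_sum_likelihoodRatio_le (hp0 : ∀ u y, 0 ≤ p u y) (hp1 : ∀ u, ∑ y, p u y = 1)
    (φ : M → V →ₗ[F] U) (m m' : M) (n : ℕ) :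
    𝔼 g : Fin n → V, ∑ y, likelihood p φ g y m * (likelihood p φ g y m' /
      likelihood (cosetChannel p ((LinearMap.ker (φ m)).map (φ m'))) φ g y m') ≤ 1 := by
  simp only [likelihood, ← Finset.prod_div_distrib, ← Finset.prod_mul_distrib]
  rw [expect_sum_prod n fun v y => p (φ m v) y * (p (φ m' v) y /
    cosetChannel p ((LinearMap.ker (φ m)).map (φ m')) (φ m' v) y)]
  refine pow_le_one₀ (Finset.expect_nonneg fun v _ => Finset.sum_nonneg fun y _ => ?_)
    (expect_likelihoodRatio_le_one hp0 hp1 _ _)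
  exact mul_nonneg (hp0 _ _) (div_nonneg (hp0 _ _) (cosetChannel_nonneg hp0 _ _ _))

theorem expect_sum_sqrt_mul_sqrt (hp0 : ∀ u y, 0 ≤ p u y) (A : U → U)
    {φ : M → V →ₗ[F] U} {m : M} (hm : Function.Surjective (φ m)) (n : ℕ) :
    𝔼 g : Fin n → V, ∑ y, √(likelihood p φ g y m) * √(∏ i, p (A (φ m (g i))) (y i)) =
      (𝔼 u, ∑ y, √(p u y) * √(p (A u) y)) ^ n := by
  have h : ∀ (g : Fin n → V) y, √(likelihood p φ g y m) * √(∏ i, p (A (φ m (g i))) (y i)) =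
      ∏ i, (√(p (φ m (g i)) (y i)) * √(p (A (φ m (g i))) (y i))) := by
    intro g y
    rw [Finset.prod_mul_distrib, likelihood]
    simp only [Real.sqrt_eq_rpow]
    rw [Real.finsetProd_rpow _ _ fun i _ => hp0 _ _, Real.finsetProd_rpow _ _ fun i _ => hp0 _ _]
  simp only [h]
  rw [expect_sum_prod n fun v y => √(p (φ m v) y) * √(p (A (φ m v)) y),
    expect_comp_of_surjective hm fun u => ∑ y, √(p u y) * √(p (A u) y)]

/-- For a random linear image of the codebook `φ`, there is a decoder such that the error
probability of each good message is bounded by three contributions: atypical outputs, competing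
messages that are not determined by the sent codeword, and those that are. -/
theorem exists_decoder_error_le [Nonempty M] [Finite M] (hp0 : ∀ u y, 0 ≤ p u y)
    (hp1 : ∀ u, ∑ y, p u y = 1) (n : ℕ) (φ : M → V →ₗ[F] U) (good : Set M)
    (hsurj : ∀ m ∈ good, Function.Surjective (φ m))
    (𝓛 : Finset (Submodule F U)) (𝓐 : Finset (U →ₗ[F] U)) (T s N : Submodule F U → ℝ)
    (hT : ∀ L ∈ 𝓛, 0 < T L) (hs : ∀ L ∈ 𝓛, 0 ≤ s L)
    (hN : ∀ m ∈ good, ∀ L ∈ 𝓛,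
      (Set.ncard {m' ∈ good | (LinearMap.ker (φ m)).map (φ m') = L} : ℝ) ≤ N L)
    (hL : ∀ m ∈ good, ∀ m' ∈ good, m' ≠ m → (LinearMap.ker (φ m)).map (φ m') ∈ 𝓛 ∨
      ∃ A ∈ 𝓐, φ m' = A ∘ₗ φ m) :
    ∃ dec : (Fin n → V) → (Fin n → Y) → M, ∀ m ∈ good,
      𝔼 g : Fin n → V, ∑ y, (open Classical in if dec g y = m then 0 else likelihood p φ g y m) ≤
        ∑ L ∈ 𝓛, (T L ^ s L * (𝔼 u, ∑ y, p u y ^ (1 - s L) * cosetChannel p L u y ^ s L) ^ n +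
          N L / T L) + ∑ A ∈ 𝓐, (𝔼 u, ∑ y, √(p u y) * √(p (A u) y)) ^ n := by
  classical
  have _ := Fintype.ofFinite M
  -- Passing the thresholds controls the competitors with a type in `𝓛`; maximality of the
  -- likelihood controls those determined by the sent codeword.
  obtain ⟨dec, hdec⟩ := exists_argmax_decoder
    (fun (g : Fin n → V) (y : Fin n → Y) => {m | m ∈ good ∧ ∀ L ∈ 𝓛,
      T L * likelihood (cosetChannel p L) φ g y m ≤ likelihood p φ g y m})
    (fun g y m => likelihood p φ g y m)
  refine ⟨dec, fun m hm => ?_⟩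
  set C : Submodule F U → Finset M := fun L =>
    {m' : M | m' ∈ good ∧ (LinearMap.ker (φ m)).map (φ m') = L}
  set a : Submodule F U → (Fin n → V) → (Fin n → Y) → ℝ := fun L g y =>
    likelihood p φ g y m ^ (1 - s L) * (T L * likelihood (cosetChannel p L) φ g y m) ^ s L
  set r : Submodule F U → M → (Fin n → V) → (Fin n → Y) → ℝ := fun L m' g y =>
    likelihood p φ g y m * (likelihood p φ g y m' / likelihood (cosetChannel p L) φ g y m')
  set t : (U →ₗ[F] U) → (Fin n → V) → (Fin n → Y) → ℝ := fun A g y =>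
    √(likelihood p φ g y m) * √(∏ i, p (A (φ m (g i))) (y i))
  have lik0 : ∀ g y m', 0 ≤ likelihood p φ g y m' := likelihood_nonneg hp0 φ (n := n)
  have av0 : ∀ L g y m', 0 ≤ likelihood (cosetChannel p L) φ g y m' := fun L =>
    likelihood_nonneg (cosetChannel_nonneg (F := F) hp0 L) φ (n := n)
  have a0 : ∀ L ∈ 𝓛, ∀ g y, 0 ≤ a L g y := fun L hL g y =>
    mul_nonneg (Real.rpow_nonneg (lik0 _ _ _) _)
      (Real.rpow_nonneg (mul_nonneg (hT L hL).le (av0 _ _ _ _)) _)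
  have r0 : ∀ L m' g y, 0 ≤ r L m' g y := fun L m' g y =>
    mul_nonneg (lik0 _ _ _) (div_nonneg (lik0 _ _ _) (av0 _ _ _ _))
  have t0 : ∀ A g y, 0 ≤ t A g y := fun A g y => by positivity
  have sa0 : ∀ g y, 0 ≤ ∑ L ∈ 𝓛, a L g y := fun g y => Finset.sum_nonneg fun L hL => a0 L hL g y
  have sr0 : ∀ g y, 0 ≤ ∑ L ∈ 𝓛, (∑ m' ∈ C L, r L m' g y) / T L := fun g y =>
    Finset.sum_nonneg fun L hL =>
      div_nonneg (Finset.sum_nonneg fun m' _ => r0 L m' g y) (hT L hL).le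
  have st0 : ∀ g y, 0 ≤ ∑ A ∈ 𝓐, t A g y := fun g y => Finset.sum_nonneg fun A _ => t0 A g y
  have pointwise : ∀ g y, (if dec g y = m then 0 else likelihood p φ g y m) ≤
      ∑ L ∈ 𝓛, a L g y + ∑ L ∈ 𝓛, (∑ m' ∈ C L, r L m' g y) / T L + ∑ A ∈ 𝓐, t A g y := by
    intro g y
    have hsa := sa0 g y
    have hsr := sr0 g y
    have hst := st0 g y
    split_ifs with hdm
    · positivity
    rcases (lik0 g y m).eq_or_lt with h0 | hpos
    · rw [← h0]; positivity
    by_cases hS : ∀ L ∈ 𝓛, T L * likelihood (cosetChannel p L) φ g y m ≤ likelihood p φ g y m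
    · obtain ⟨⟨hgood, hthr⟩, hmax⟩ := hdec g y m ⟨hm, hS⟩
      set m' := dec g y
      have hpos' : 0 < likelihood p φ g y m' := hpos.trans_le hmax
      rcases hL m hm m' hgood hdm with hL' | ⟨A, hA, hAm⟩
      · obtain ⟨L, hLeq⟩ : ∃ L, (LinearMap.ker (φ m)).map (φ m') = L := ⟨_, rfl⟩
        rw [hLeq] at hL'
        have hav : 0 < likelihood (cosetChannel p L) φ g y m' :=
          Finset.prod_pos fun i hi => cosetChannel_pos (F := F) hp0 _ <|
            (hp0 _ _).lt_of_ne' (Finset.prod_ne_zero_iff.1 hpos'.ne' i hi)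
        -- The competitor has passed the threshold of its own type `L`, so its likelihood ratio is
        -- at least `T L`.
        have h1 : likelihood p φ g y m ≤ r L m' g y / T L := by
          rw [le_div_iff₀ (hT L hL')]
          refine mul_le_mul_of_nonneg_left ?_ hpos.le
          rw [le_div_iff₀ hav]
          exact hthr L hL'
        have h2 : r L m' g y ≤ ∑ m' ∈ C L, r L m' g y :=
          Finset.single_le_sum (f := fun m' => r L m' g y) (fun m' _ => r0 L m' g y)
            (Finset.mem_filter.2 ⟨Finset.mem_univ _, hgood, hLeq⟩)
        have h3 := Finset.single_le_sum (f := fun L => (∑ m' ∈ C L, r L m' g y) / T L)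
          (fun L hL => div_nonneg (Finset.sum_nonneg fun m' _ => r0 L m' g y) (hT L hL).le) hL'
        have h4 := div_le_div_of_nonneg_right h2 (hT _ hL').le
        linarith
      -- The decoder preferred `m'`, so one factor `√(likelihood m)` may be replaced by
      -- `√(likelihood m')`.
      · have h1 : likelihood p φ g y m ≤ t A g y := by
          have : ∏ i, p (A (φ m (g i))) (y i) = likelihood p φ g y m' := by
            simp only [likelihood, hAm, LinearMap.comp_apply]
          simp only [t, this]
          calc likelihood p φ g y m = √(likelihood p φ g y m) * √(likelihood p φ g y m) :=
                (Real.mul_self_sqrt hpos.le).symm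
            _ ≤ _ := by gcongr
        have h2 := Finset.single_le_sum (f := fun A => t A g y) (fun A _ => t0 A g y) hA
        linarith
    · push Not at hS
      obtain ⟨L, hL', hlt⟩ := hS
      have h1 : likelihood p φ g y m ≤ a L g y := le_rpow_mul_rpow hpos.le hlt.le (hs L hL')
      have h2 := Finset.single_le_sum (f := fun L => a L g y) (fun L hL => a0 L hL g y) hL'
      linarith
  have key : ∀ L ∈ 𝓛, (∑ m' ∈ C L, 𝔼 g, ∑ y, r L m' g y) / T L ≤ N L / T L := by
    intro L hL'
    refine div_le_div_of_nonneg_right ?_ (hT L hL').le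
    calc ∑ m' ∈ C L, 𝔼 g, ∑ y, r L m' g y ≤ ∑ m' ∈ C L, 1 := by
          refine Finset.sum_le_sum fun m' hm' => ?_
          obtain rfl := (Finset.mem_filter.1 hm').2.2
          exact expect_sum_likelihoodRatio_le hp0 hp1 φ m m' n
      _ = (C L).card := by simp
      _ ≤ N L := by
          refine le_trans (le_of_eq ?_) (hN m hm L hL')
          rw [← Set.ncard_coe_finset]
          simp [C]
  calc _ ≤ 𝔼 g, ∑ y, (∑ L ∈ 𝓛, a L g y + ∑ L ∈ 𝓛, (∑ m' ∈ C L, r L m' g y) / T L +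
        ∑ A ∈ 𝓐, t A g y) :=
        Finset.expect_le_expect fun g _ => Finset.sum_le_sum fun y _ => pointwise g y
    _ = ∑ L ∈ 𝓛, 𝔼 g, ∑ y, a L g y + ∑ L ∈ 𝓛, (∑ m' ∈ C L, 𝔼 g, ∑ y, r L m' g y) / T L +
        ∑ A ∈ 𝓐, 𝔼 g, ∑ y, t A g y := by
        simp only [Finset.sum_add_distrib, Finset.expect_add_distrib]
        congr 1
        · congr 1
          · rw [← Finset.expect_sum_comm]
            exact Finset.expect_congr rfl fun g _ => Finset.sum_comm
          · simp only [← Finset.expect_sum_comm, Finset.expect_div]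
            refine Finset.expect_congr rfl fun g _ => ?_
            rw [Finset.sum_comm]
            refine Finset.sum_congr rfl fun L _ => ?_
            rw [← Finset.sum_div, Finset.sum_comm]
        · rw [← Finset.expect_sum_comm]
          exact Finset.expect_congr rfl fun g _ => Finset.sum_comm
    _ ≤ _ := by
        rw [Finset.sum_add_distrib]
        refine add_le_add (add_le_add (Finset.sum_le_sum fun L hL' => ?_)
          (Finset.sum_le_sum key)) (Finset.sum_le_sum fun A _ => ?_)
        · exact (expect_sum_rpow_mul_rpow hp0 (hT L hL').le (hsurj m hm) n).le
        · exact (expect_sum_sqrt_mul_sqrt hp0 A (hsurj m hm) n).le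

end Decoding

/-! ### Vanishing error probability -/

theorem sum_likelihood {F U V Y M : Type*} [Field F] [AddCommGroup U] [Module F U]
    [AddCommGroup V] [Module F V] [Fintype Y] {p : U → Y → ℝ} (hp1 : ∀ u, ∑ y, p u y = 1)
    (φ : M → V →ₗ[F] U) {n : ℕ} (g : Fin n → V) (m : M) :
    ∑ y : Fin n → Y, likelihood p φ g y m = 1 := by
  have := Finset.prod_univ_sum (fun _ : Fin n => (Finset.univ : Finset Y))
    fun i y => p (φ m (g i)) y
  rw [Fintype.piFinset_univ] at this
  simp only [likelihood, ← this, hp1, Finset.prod_const_one]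

open Classical in
/-- The average probability of error, for uniform messages, when the letters of the codewords are the
images of the letters of `g` under the maps `φ m`. -/
noncomputable def imageError {F U V Y M : Type*} [Field F] [AddCommGroup U] [Module F U]
    [AddCommGroup V] [Module F V] [Fintype Y] [Fintype M] (p : U → Y → ℝ) (φ : M → V →ₗ[F] U)
    {n : ℕ} (g : Fin n → V) (dec : (Fin n → Y) → M) : ℝ :=
  𝔼 m, ∑ y, if dec y = m then 0 else likelihood p φ g y m

section Vanishing

variable {F U Y : Type*} [Field F] [AddCommGroup U] [Module F U] [Fintype U] [Fintype Y]
  {p : U → Y → ℝ}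

/-- With `T n L = b ^ (n * τ)` and `τ` between `R L` and the information, the Chernoff term, the
competitor term `c * b ^ (n * (R L - τ))` and the Bhattacharyya terms all decay geometrically. -/
theorem exists_vanishing_bound {b : ℝ} (hb : 1 < b) (hp0 : ∀ u y, 0 ≤ p u y)
    (hp1 : ∀ u, ∑ y, p u y = 1) (𝓛 : Finset (Submodule F U)) (R : Submodule F U → ℝ)
    (hR : ∀ L ∈ 𝓛, R L < cosetInfo b p L) (𝓐 : Finset (U →ₗ[F] U))
    (h𝓐 : ∀ A ∈ 𝓐, ∃ u, p (A u) ≠ p u) (c : ℝ) :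
    ∃ (B : ℕ → ℝ) (T : ℕ → Submodule F U → ℝ) (s : Submodule F U → ℝ),
      Filter.Tendsto B Filter.atTop (𝓝 0) ∧ (∀ n, ∀ L ∈ 𝓛, 0 < T n L) ∧ (∀ L ∈ 𝓛, 0 ≤ s L) ∧
      ∀ n : ℕ, ∑ L ∈ 𝓛,
        (T n L ^ s L * (𝔼 u, ∑ y, p u y ^ (1 - s L) * cosetChannel p L u y ^ s L) ^ n +
          c * b ^ (n * R L) / T n L) +
        ∑ A ∈ 𝓐, (𝔼 u, ∑ y, √(p u y) * √(p (A u) y)) ^ n = B n := by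
  have hb0 : 0 < b := by linarith
  have h : ∀ L : Submodule F U, ∃ τ s : ℝ, L ∈ 𝓛 → R L < τ ∧ 0 < s ∧ s < 1 ∧
      b ^ (τ * s) * 𝔼 u, ∑ y, p u y ^ (1 - s) * cosetChannel p L u y ^ s < 1 := by
    intro L
    by_cases hL : L ∈ 𝓛
    · obtain ⟨τ, s, h⟩ := exists_chernoff_lt_one hb hp0 hp1 L (hR L hL)
      exact ⟨τ, s, fun _ => h⟩
    · exact ⟨0, 0, fun h => absurd h hL⟩
  choose τ s hτs using h
  refine ⟨_, fun n L => b ^ (n * τ L), s, ?_, fun n L _ => Real.rpow_pos_of_pos hb0 _,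
    fun L hL => (hτs L hL).2.1.le, fun n => rfl⟩
  have hA : Filter.Tendsto (fun n : ℕ => ∑ A ∈ 𝓐, (𝔼 u, ∑ y, √(p u y) * √(p (A u) y)) ^ n)
      Filter.atTop (𝓝 0) := by
    rw [← Finset.sum_const_zero (s := 𝓐)]
    refine tendsto_finsetSum _ fun A hA => tendsto_pow_atTop_nhds_zero_of_lt_one
      (Finset.expect_nonneg fun u _ => Finset.sum_nonneg fun y _ => by positivity)
      (bhattacharyya_lt_one hp0 hp1 (h𝓐 A hA))
  rw [← add_zero (0 : ℝ)]
  refine Filter.Tendsto.add ?_ hA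
  rw [← Finset.sum_const_zero (s := 𝓛)]
  refine tendsto_finsetSum _ fun L hL => ?_
  obtain ⟨h1, h2, h3, h4⟩ := hτs L hL
  rw [← add_zero (0 : ℝ)]
  refine Filter.Tendsto.add ?_ ?_
  · have : ∀ n : ℕ, (b ^ (n * τ L)) ^ s L *
        (𝔼 u, ∑ y, p u y ^ (1 - s L) * cosetChannel p L u y ^ s L) ^ n =
        (b ^ (τ L * s L) * 𝔼 u, ∑ y, p u y ^ (1 - s L) * cosetChannel p L u y ^ s L) ^ n := by
      intro n
      rw [mul_pow, ← Real.rpow_mul hb0.le, ← Real.rpow_mul_natCast hb0.le]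
      ring_nf
    simp only [this]
    refine tendsto_pow_atTop_nhds_zero_of_lt_one (mul_nonneg (Real.rpow_nonneg hb0.le _)
      (Finset.expect_nonneg fun u _ => Finset.sum_nonneg fun y _ => ?_)) h4
    exact mul_nonneg (Real.rpow_nonneg (hp0 _ _) _)
      (Real.rpow_nonneg (cosetChannel_nonneg hp0 _ _ _) _)
  · have : ∀ n : ℕ, c * b ^ (n * R L) / b ^ (n * τ L) = c * (b ^ (R L - τ L)) ^ n := by
      intro n
      rw [mul_div_assoc, ← Real.rpow_sub hb0, ← Real.rpow_mul_natCast hb0.le]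
      ring_nf
    simp only [this]
    rw [← mul_zero c]
    exact (tendsto_pow_atTop_nhds_zero_of_lt_one (Real.rpow_nonneg hb0.le _)
      (Real.rpow_lt_one_of_one_lt_of_neg hb (by linarith))).const_mul c

/-- If the codebooks `φ` are injective enough and the number of competing messages of each kind
is less than the information allows, then the error probability of random linear images of the
codebooks tends to zero, up to the fraction of bad messages. -/
theorem exists_vanishing_error.{v} {b : ℝ} (hb : 1 < b) (hp0 : ∀ u y, 0 ≤ p u y)
    (hp1 : ∀ u, ∑ y, p u y = 1) (𝓛 : Finset (Submodule F U)) (R : Submodule F U → ℝ)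
    (hR : ∀ L ∈ 𝓛, R L < cosetInfo b p L) (𝓐 : Finset (U →ₗ[F] U))
    (h𝓐 : ∀ A ∈ 𝓐, ∃ u, p (A u) ≠ p u) (c : ℝ) :
    ∃ B : ℕ → ℝ, Filter.Tendsto B Filter.atTop (𝓝 0) ∧
      ∀ (n : ℕ) (V M : Type v) [AddCommGroup V] [Module F V] [Fintype V] [Nonempty M] [Fintype M]
        (φ : M → V →ₗ[F] U) (good : Set M), (∀ m ∈ good, Function.Surjective (φ m)) →
        (∀ m ∈ good, ∀ L ∈ 𝓛,
          (Set.ncard {m' ∈ good | (LinearMap.ker (φ m)).map (φ m') = L} : ℝ) ≤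
            c * b ^ (n * R L)) →
        (∀ m ∈ good, ∀ m' ∈ good, m' ≠ m → (LinearMap.ker (φ m)).map (φ m') ∈ 𝓛 ∨
          ∃ A ∈ 𝓐, φ m' = A ∘ₗ φ m) →
        ∃ dec : (Fin n → V) → (Fin n → Y) → M,
          𝔼 g : Fin n → V, imageError p φ g (dec g) ≤
          (Set.ncard goodᶜ : ℝ) / Fintype.card M + B n := by
  classical
  obtain ⟨B, T, s, hB, hT, hs, hTs⟩ := exists_vanishing_bound hb hp0 hp1 𝓛 R hR 𝓐 h𝓐 c
  -- The absolute value lets the same summand be added for bad messages, whose error is only bounded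
  -- by 1.
  refine ⟨fun n => |B n|, by simpa using hB.abs, ?_⟩
  intro n V M _ _ _ _ _ φ good hsurj hN hL
  obtain ⟨dec, hdec⟩ := exists_decoder_error_le hp0 hp1 n φ good hsurj 𝓛 𝓐 (T n) s
    (fun L => c * b ^ (n * R L)) (hT n) hs hN hL
  refine ⟨dec, ?_⟩
  rw [hTs n] at hdec
  simp only [imageError]
  rw [Finset.expect_comm]
  have hm : ∀ m, 𝔼 g : Fin n → V, ∑ y, (if dec g y = m then 0 else likelihood p φ g y m) ≤
      (if m ∈ goodᶜ then 1 else 0) + |B n| := by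
    intro m
    by_cases h : m ∈ good
    · simpa [h] using (hdec m h).trans (le_abs_self _)
    · have : 𝔼 g : Fin n → V, ∑ y, (if dec g y = m then 0 else likelihood p φ g y m) ≤ 1 := by
        refine Finset.expect_le Finset.univ_nonempty fun g _ => ?_
        rw [← sum_likelihood hp1 φ g m]
        refine Finset.sum_le_sum fun y _ => ?_
        split_ifs
        · exact likelihood_nonneg hp0 φ g y m
        · exact le_rfl
      simpa [h] using this.trans (le_add_of_nonneg_right (abs_nonneg (B n)))
  refine (Finset.expect_le_expect fun m _ => hm m).trans (le_of_eq ?_)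
  rw [Finset.expect_add_distrib, Fintype.expect_const, Fintype.expect_eq_sum_div_card,
    Finset.sum_boole, ← Set.ncard_coe_finset]
  simp [Set.compl_def]

end Vanishing

/-! ### Evaluation of the information measures -/

/-! ### Superadditivity of information over complementary cosets -/

section Superadditive

variable {F U Y : Type*} [Field F] [AddCommGroup U] [Module F U] [Fintype U] {p : U → Y → ℝ}

/-- If `L` and `K` together span the input space, then the averages of the channel over the cosets
of `L` and of `K` are uncorrelated. -/
theorem expect_cosetChannel_mul_cosetChannel {L K : Submodule F U} (h : L ⊔ K = ⊤) (y : Y) :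
    𝔼 u, cosetChannel p L u y * cosetChannel p K u y = (𝔼 u, p u y) * 𝔼 u, p u y := by
  -- Averaging over both `L` and `K` gives a function invariant under `L ⊔ K = ⊤`, hence the
  -- constant `𝔼 u, p u y`.
  set G : U → ℝ := fun u => subspaceAvg L fun l => cosetChannel p K (u + l) y
  have hE : ∀ J : Submodule F U, 𝔼 u, cosetChannel p J u y = 𝔼 u, p u y := fun J =>
    expect_subspaceAvg J fun u => p u y
  have hG : ∀ u, G u = 𝔼 u, p u y := by
    have hconst : ∀ u, G u = G 0 := by
      intro u
      obtain ⟨l, hl, k, hk, rfl⟩ := Submodule.mem_sup.1 (h ▸ Submodule.mem_top : u ∈ L ⊔ K)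
      calc G (l + k) = subspaceAvg L fun v => cosetChannel p K (v + l) y := by
            refine subspaceAvg_congr fun v _ => ?_
            rw [← cosetChannel_add K (v + l) hk]
            congr 1
            abel
        _ = G 0 := by
            rw [subspaceAvg_shift hl fun v => cosetChannel p K v y]
            simp only [G, zero_add]
    intro u
    rw [hconst u, ← hE K, ← expect_subspaceAvg L fun u => cosetChannel p K u y]
    change _ = 𝔼 v, G v
    simp only [hconst, Fintype.expect_const]
  calc 𝔼 u, cosetChannel p L u y * cosetChannel p K u y
      = 𝔼 u, cosetChannel p L u y * G u := by
        rw [← expect_subspaceAvg L]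
        refine Finset.expect_congr rfl fun u _ => ?_
        rw [mul_subspaceAvg]
        exact subspaceAvg_congr fun l hl => by rw [cosetChannel_add L u hl]
    _ = _ := by simp only [hG, ← Finset.expect_mul, hE]

/-- For uniform `U` the cosets `U + L` and `U + K` are independent, so `I(U + L; Y) + I(U + K; Y) ≤
I(U; Y)`, which is the claim rearranged. The proof applies `log x ≥ 1 - 1 / x` to `x = p c / (p_L
p_K)`, where `c` is the output law; the correction terms average to zero because `p_L` and `p_K` are
uncorrelated. -/
theorem cosetInfo_top_le_add [Fintype Y] {b : ℝ} (hb : 1 < b) (hp0 : ∀ u y, 0 ≤ p u y)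
    (hp1 : ∀ u, ∑ y, p u y = 1) {L K : Submodule F U} (h : L ⊔ K = ⊤) :
    cosetInfo b p (⊤ : Submodule F U) ≤ cosetInfo b p L + cosetInfo b p K := by
  have hlb : 0 < Real.log b := Real.log_pos hb
  set c : Y → ℝ := fun y => 𝔼 u, p u y
  have hc0 : ∀ y, 0 ≤ c y := fun y => Finset.expect_nonneg fun u _ => hp0 u y
  have hc1 : ∑ y, c y = 1 := by
    simp only [c]
    rw [← Finset.expect_sum_comm]
    simp only [hp1, Fintype.expect_one]
  have hterm : ∀ u y, p u y * Real.logb b (p u y / cosetChannel p (⊤ : Submodule F U) u y) +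
      (p u y - cosetChannel p L u y * cosetChannel p K u y / c y) / Real.log b ≤
      p u y * Real.logb b (p u y / cosetChannel p L u y) +
      p u y * Real.logb b (p u y / cosetChannel p K u y) := by
    intro u y
    have hL0 := cosetChannel_nonneg hp0 L u y
    have hK0 := cosetChannel_nonneg hp0 K u y
    rcases (hp0 u y).eq_or_lt with hp | hp
    · rw [← hp]
      have := div_nonneg (mul_nonneg hL0 hK0) (hc0 y)
      have := div_nonneg this hlb.le
      simp only [zero_mul, zero_sub, neg_div, add_zero, zero_add]
      linarith
    · have hL := cosetChannel_pos hp0 L hp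
      have hK := cosetChannel_pos hp0 K hp
      have hc : 0 < c y := by
        have := cosetChannel_pos hp0 (⊤ : Submodule F U) hp
        rwa [cosetChannel_top] at this
      rw [cosetChannel_top]
      change p u y * Real.logb b (p u y / c y) + _ ≤ _
      have key := Real.one_sub_inv_le_log_of_pos
        (x := p u y * c y / (cosetChannel p L u y * cosetChannel p K u y)) (by positivity)
      have h2 := mul_le_mul_of_nonneg_left key hp.le
      rw [Real.log_div (by positivity) (by positivity), Real.log_mul hp.ne' hc.ne',
        Real.log_mul hL.ne' hK.ne'] at h2
      simp only [← Real.log_div_log, Real.log_div hp.ne' hc.ne', Real.log_div hp.ne' hL.ne',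
        Real.log_div hp.ne' hK.ne']
      simp only [mul_div_assoc', ← add_div]
      refine div_le_div_of_nonneg_right ?_ hlb.le
      have h3 : p u y * (1 - (p u y * c y / (cosetChannel p L u y * cosetChannel p K u y))⁻¹) =
          p u y - cosetChannel p L u y * cosetChannel p K u y / c y := by
        field_simp
      rw [h3] at h2
      linarith
  have hsum : 𝔼 u, ∑ y, (p u y - cosetChannel p L u y * cosetChannel p K u y / c y) / Real.log b
      = 0 := by
    simp only [← Finset.sum_div, ← Finset.expect_div, Finset.sum_sub_distrib, hp1,
      Finset.expect_sub_distrib, Fintype.expect_const]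
    rw [Finset.expect_sum_comm]
    simp only [← Finset.expect_div, expect_cosetChannel_mul_cosetChannel h]
    -- Also true for outputs of probability zero, since `0 / 0 = 0`.
    have : ∀ y, c y * c y / c y = c y := fun y => by
      rcases eq_or_ne (c y) 0 with h0 | h0
      · simp [h0]
      · field_simp
    change (1 - ∑ y, c y * c y / c y) / Real.log b = 0
    simp only [this, hc1, sub_self, zero_div]
  have := Finset.expect_le_expect (s := Finset.univ)
    fun u _ => Finset.sum_le_sum (s := Finset.univ) fun y _ => hterm u y
  simp only [Finset.sum_add_distrib, Finset.expect_add_distrib] at this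
  rw [hsum, add_zero] at this
  exact this

end Superadditive

/-! ### Entropies as averages over input pairs and outputs -/

section Information

variable {F Y : Type*}

/-- Pulled back to the sample space, all entropies are averages over the same triples, so identities
between information measures can be checked term by term. -/
theorem entropy_eq_sum {Ω A : Type*} [Fintype Ω] [Fintype A] (b : ℝ) (P : Ω → ℝ) (X : Ω → A) :
    entropy b P X = -∑ ω, P ω * Real.logb b (law P X (X ω)) := by
  classical
  unfold entropy
  congr 1
  have : ∀ a, law P X a * Real.logb b (law P X a) =
      ∑ ω, if X ω = a then P ω * Real.logb b (law P X (X ω)) else 0 := by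
    intro a
    conv_lhs => rw [law, Finset.sum_mul]
    refine Finset.sum_congr rfl fun ω _ => ?_
    split_ifs with h
    · rw [h]; rfl
    · rw [zero_mul]
  simp only [this]
  rw [Finset.sum_comm]
  simp

/-- The channel from pairs of inputs. -/
noncomputable def pairChannel (V : F → F → PMF Y) (u : F × F) (y : Y) : ℝ := (V u.1 u.2 y).toReal

theorem pairChannel_nonneg (V : F → F → PMF Y) (u : F × F) (y : Y) : 0 ≤ pairChannel V u y :=
  ENNReal.toReal_nonneg

theorem sum_pairChannel [Fintype Y] (V : F → F → PMF Y) (u : F × F) : ∑ y, pairChannel V u y = 1 := by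
  have := (V u.1 u.2).tsum_coe
  rw [tsum_fintype] at this
  unfold pairChannel
  rw [← ENNReal.toReal_sum fun y _ => (V u.1 u.2).apply_ne_top y, this, ENNReal.toReal_one]

theorem sum_uniformInputPmf_mul [Field F] [Fintype F] [Fintype Y] (V : F → F → PMF Y) (h : F × F × Y → ℝ) :
    ∑ ω, uniformInputPmf V ω * h ω = 𝔼 u : F × F, ∑ y, pairChannel V u y * h (u.1, u.2, y) := by
  rw [Fintype.expect_eq_sum_div_card, Fintype.sum_prod_type, Fintype.sum_prod_type,
    Finset.sum_div, Fintype.card_prod]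
  refine Finset.sum_congr rfl fun a _ => ?_
  rw [Fintype.sum_prod_type, Finset.sum_div]
  refine Finset.sum_congr rfl fun a' _ => ?_
  rw [Finset.sum_div]
  refine Finset.sum_congr rfl fun y _ => ?_
  simp only [uniformInputPmf, pairChannel]
  push_cast
  field_simp

theorem entropy_uniformInputPmf {A : Type*} [Field F] [Fintype F] [Fintype Y] [Fintype A] (b : ℝ) (V : F → F → PMF Y)
    (X : F × F × Y → A) :
    entropy b (uniformInputPmf V) X = 𝔼 u : F × F, ∑ y, pairChannel V u y *
      -Real.logb b (law (uniformInputPmf V) X (X (u.1, u.2, y))) := by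
  rw [entropy_eq_sum, ← Finset.sum_neg_distrib, ← sum_uniformInputPmf_mul V
    fun ω => -Real.logb b (law (uniformInputPmf V) X (X ω))]
  simp only [mul_neg]

theorem law_uniformInputPmf {A : Type*} [Fintype F] [Fintype Y] (V : F → F → PMF Y) (X : F × F × Y → A) (x : A) :
    law (uniformInputPmf V) X x = 1 / (Fintype.card F : ℝ) * (1 / (Fintype.card F : ℝ) *
      ∑ a, ∑ c, ∑ y, open Classical in if X (a, c, y) = x then pairChannel V (a, c) y else 0) := by
  classical
  simp only [law, Fintype.sum_prod_type, uniformInputPmf, Finset.mul_sum, mul_ite, mul_zero,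
    pairChannel, mul_assoc]

/-! ### Marginal laws of the inputs and the output -/

section Laws

variable [Fintype F] [Fintype Y]

theorem law_fst [Nonempty F] (V : F → F → PMF Y) (a : F) :
    law (uniformInputPmf V) (fun ω => ω.1) a = 1 / Fintype.card F := by
  classical
  have h : ∀ x, (∑ c, ∑ y, if x = a then pairChannel V (x, c) y else 0) =
      if x = a then (Fintype.card F : ℝ) else 0 := by
    intro x
    split_ifs <;> simp [sum_pairChannel]
  simp [law_uniformInputPmf, h]

theorem law_snd [Nonempty F] (V : F → F → PMF Y) (c : F) :
    law (uniformInputPmf V) (fun ω => ω.2.1) c = 1 / Fintype.card F := by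
  classical
  have h : ∀ x x', (∑ y, if x' = c then pairChannel V (x, x') y else 0) =
      if x' = c then (1 : ℝ) else 0 := by
    intro x x'
    split_ifs <;> simp [sum_pairChannel]
  simp [law_uniformInputPmf, h]

theorem law_output (V : F → F → PMF Y) (y : Y) :
    law (uniformInputPmf V) (fun ω => ω.2.2) y = 𝔼 u, pairChannel V u y := by
  classical
  simp [law_uniformInputPmf, Fintype.expect_eq_sum_div_card, Fintype.sum_prod_type]
  field_simp

theorem law_inputs (V : F → F → PMF Y) (a c : F) :
    law (uniformInputPmf V) (fun ω => (ω.1, ω.2.1)) (a, c) =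
      1 / Fintype.card F * (1 / Fintype.card F) := by
  classical
  simp [law_uniformInputPmf, ite_and, Finset.sum_ite_irrel, sum_pairChannel]

theorem law_inputs_swap (V : F → F → PMF Y) (a c : F) :
    law (uniformInputPmf V) (fun ω => (ω.2.1, ω.1)) (c, a) =
      1 / Fintype.card F * (1 / Fintype.card F) := by
  classical
  simp [law_uniformInputPmf, ite_and, Finset.sum_ite_irrel, sum_pairChannel]

theorem law_fst_output (V : F → F → PMF Y) (a : F) (y : Y) :
    law (uniformInputPmf V) (fun ω => (ω.1, ω.2.2)) (a, y) =
      1 / Fintype.card F * 𝔼 c, pairChannel V (a, c) y := by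
  classical
  simp [law_uniformInputPmf, ite_and, Finset.sum_ite_irrel, Fintype.expect_eq_sum_div_card]
  exact Or.inl (by field_simp)

theorem law_output_fst (V : F → F → PMF Y) (a : F) (y : Y) :
    law (uniformInputPmf V) (fun ω => (ω.2.2, ω.1)) (y, a) =
      1 / Fintype.card F * 𝔼 c, pairChannel V (a, c) y := by
  classical
  simp [law_uniformInputPmf, ite_and, Finset.sum_ite_irrel, Fintype.expect_eq_sum_div_card]
  exact Or.inl (by field_simp)

theorem law_snd_output (V : F → F → PMF Y) (c : F) (y : Y) :
    law (uniformInputPmf V) (fun ω => (ω.2.1, ω.2.2)) (c, y) =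
      1 / Fintype.card F * 𝔼 a, pairChannel V (a, c) y := by
  classical
  simp [law_uniformInputPmf, ite_and, Finset.sum_ite_irrel, Fintype.expect_eq_sum_div_card]
  exact Or.inl (by field_simp)

theorem law_output_snd (V : F → F → PMF Y) (c : F) (y : Y) :
    law (uniformInputPmf V) (fun ω => (ω.2.2, ω.2.1)) (y, c) =
      1 / Fintype.card F * 𝔼 a, pairChannel V (a, c) y := by
  classical
  simp [law_uniformInputPmf, ite_and, Fintype.expect_eq_sum_div_card]
  exact Or.inl (by field_simp)

theorem law_inputs_output (V : F → F → PMF Y) (a c : F) (y : Y) :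
    law (uniformInputPmf V) (fun ω => ((ω.1, ω.2.1), ω.2.2)) ((a, c), y) =
      1 / Fintype.card F * (1 / Fintype.card F) * pairChannel V (a, c) y := by
  classical
  simp [law_uniformInputPmf, ite_and, Finset.sum_ite_irrel, mul_assoc]

theorem law_fst_output_snd (V : F → F → PMF Y) (a c : F) (y : Y) :
    law (uniformInputPmf V) (fun ω => (ω.1, ω.2.2, ω.2.1)) (a, y, c) =
      1 / Fintype.card F * (1 / Fintype.card F) * pairChannel V (a, c) y := by
  classical
  simp [law_uniformInputPmf, ite_and, Finset.sum_ite_irrel, mul_assoc]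

theorem law_snd_output_fst (V : F → F → PMF Y) (a c : F) (y : Y) :
    law (uniformInputPmf V) (fun ω => (ω.2.1, ω.2.2, ω.1)) (c, y, a) =
      1 / Fintype.card F * (1 / Fintype.card F) * pairChannel V (a, c) y := by
  classical
  simp [law_uniformInputPmf, ite_and, Finset.sum_ite_irrel, mul_assoc]

end Laws

variable [Field F] [Fintype F]

theorem cosetChannel_ker_fst (p : F × F → Y → ℝ) (u : F × F) (y : Y) :
    cosetChannel p (LinearMap.ker (LinearMap.fst F F F)) u y = 𝔼 c, p (u.1, c) y := by
  unfold cosetChannel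
  rw [LinearMap.ker_fst, LinearMap.range_eq_map, subspaceAvg_map, subspaceAvg_top,
    ← expect_shift u.2 fun c => p (u.1, c) y]
  refine Finset.expect_congr rfl fun c _ => ?_
  congr 1
  ext <;> simp [add_comm]

theorem cosetChannel_ker_snd (p : F × F → Y → ℝ) (u : F × F) (y : Y) :
    cosetChannel p (LinearMap.ker (LinearMap.snd F F F)) u y = 𝔼 a, p (a, u.2) y := by
  unfold cosetChannel
  rw [LinearMap.ker_snd, LinearMap.range_eq_map, subspaceAvg_map, subspaceAvg_top,
    ← expect_shift u.1 fun a => p (a, u.2) y]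
  refine Finset.expect_congr rfl fun a _ => ?_
  congr 1
  ext <;> simp [add_comm]

variable [Fintype Y]

theorem mutualInfo_inputs_eq (V : F → F → PMF Y) (b : ℝ) :
    mutualInfo b (uniformInputPmf V) (fun ω => (ω.1, ω.2.1)) (fun ω => ω.2.2) =
      cosetInfo b (pairChannel V) (⊤ : Submodule F (F × F)) := by
  simp only [mutualInfo, entropy_uniformInputPmf, cosetInfo, ← Finset.expect_add_distrib,
    ← Finset.expect_sub_distrib, ← Finset.sum_add_distrib, ← Finset.sum_sub_distrib]
  refine Finset.expect_congr rfl fun u _ => Finset.sum_congr rfl fun y _ => ?_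
  rcases (pairChannel_nonneg V u y).eq_or_lt with h | h
  · simp [← h]
  have hT := cosetChannel_pos (pairChannel_nonneg V) (⊤ : Submodule F (F × F)) h
  rw [law_inputs, law_output, law_inputs_output, ← cosetChannel_top (F := F) u,
    Real.logb_mul (by positivity) h.ne', Real.logb_div h.ne' hT.ne']
  ring

theorem condMutualInfo_fst_eq (V : F → F → PMF Y) (b : ℝ) :
    condMutualInfo b (uniformInputPmf V) (fun ω => ω.1) (fun ω => ω.2.2) (fun ω => ω.2.1) =
      cosetInfo b (pairChannel V) (LinearMap.ker (LinearMap.snd F F F)) := by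
  simp only [condMutualInfo, entropy_uniformInputPmf, cosetInfo, ← Finset.expect_add_distrib,
    ← Finset.expect_sub_distrib, ← Finset.sum_add_distrib, ← Finset.sum_sub_distrib]
  refine Finset.expect_congr rfl fun u _ => Finset.sum_congr rfl fun y _ => ?_
  rcases (pairChannel_nonneg V u y).eq_or_lt with h | h
  · simp [← h]
  have hK := cosetChannel_pos (pairChannel_nonneg V) (LinearMap.ker (LinearMap.snd F F F)) h
  have hq : (1 / Fintype.card F : ℝ) ≠ 0 := by positivity
  rw [law_inputs, law_output_snd, law_fst_output_snd, law_snd, ← cosetChannel_ker_snd,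
    Real.logb_mul (by positivity) h.ne', Real.logb_div h.ne' hK.ne', Real.logb_mul hq hq,
    Real.logb_mul hq hK.ne']
  ring

theorem condMutualInfo_snd_eq (V : F → F → PMF Y) (b : ℝ) :
    condMutualInfo b (uniformInputPmf V) (fun ω => ω.2.1) (fun ω => ω.2.2) (fun ω => ω.1) =
      cosetInfo b (pairChannel V) (LinearMap.ker (LinearMap.fst F F F)) := by
  simp only [condMutualInfo, entropy_uniformInputPmf, cosetInfo, ← Finset.expect_add_distrib,
    ← Finset.expect_sub_distrib, ← Finset.sum_add_distrib, ← Finset.sum_sub_distrib]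
  refine Finset.expect_congr rfl fun u _ => Finset.sum_congr rfl fun y _ => ?_
  rcases (pairChannel_nonneg V u y).eq_or_lt with h | h
  · simp [← h]
  have hK := cosetChannel_pos (pairChannel_nonneg V) (LinearMap.ker (LinearMap.fst F F F)) h
  have hq : (1 / Fintype.card F : ℝ) ≠ 0 := by positivity
  rw [law_inputs_swap, law_output_fst, law_snd_output_fst, law_fst, ← cosetChannel_ker_fst,
    Real.logb_mul (by positivity) h.ne', Real.logb_div h.ne' hK.ne', Real.logb_mul hq hq,
    Real.logb_mul hq hK.ne']
  ring

/-- This is the chain rule `I(U₁; Y) = I(U₁, U₂; Y) - I(U₂; Y | U₁)`: knowing `U₁` means knowing the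
coset of `ker fst`. -/
theorem mutualInfo_fst_eq (V : F → F → PMF Y) (b : ℝ) :
    mutualInfo b (uniformInputPmf V) (fun ω => ω.1) (fun ω => ω.2.2) =
      cosetInfo b (pairChannel V) (⊤ : Submodule F (F × F)) -
        cosetInfo b (pairChannel V) (LinearMap.ker (LinearMap.fst F F F)) := by
  simp only [mutualInfo, entropy_uniformInputPmf, cosetInfo, ← Finset.expect_add_distrib,
    ← Finset.expect_sub_distrib, ← Finset.sum_add_distrib, ← Finset.sum_sub_distrib]
  refine Finset.expect_congr rfl fun u _ => Finset.sum_congr rfl fun y _ => ?_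
  rcases (pairChannel_nonneg V u y).eq_or_lt with h | h
  · simp [← h]
  have hT := cosetChannel_pos (pairChannel_nonneg V) (⊤ : Submodule F (F × F)) h
  have hK := cosetChannel_pos (pairChannel_nonneg V) (LinearMap.ker (LinearMap.fst F F F)) h
  have hq : (1 / Fintype.card F : ℝ) ≠ 0 := by positivity
  rw [law_fst, law_output, law_fst_output, ← cosetChannel_top (F := F) u, ← cosetChannel_ker_fst,
    Real.logb_mul hq hK.ne', Real.logb_div h.ne' hT.ne', Real.logb_div h.ne' hK.ne']
  ring

theorem mutualInfo_snd_eq (V : F → F → PMF Y) (b : ℝ) :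
    mutualInfo b (uniformInputPmf V) (fun ω => ω.2.1) (fun ω => ω.2.2) =
      cosetInfo b (pairChannel V) (⊤ : Submodule F (F × F)) -
        cosetInfo b (pairChannel V) (LinearMap.ker (LinearMap.snd F F F)) := by
  simp only [mutualInfo, entropy_uniformInputPmf, cosetInfo, ← Finset.expect_add_distrib,
    ← Finset.expect_sub_distrib, ← Finset.sum_add_distrib, ← Finset.sum_sub_distrib]
  refine Finset.expect_congr rfl fun u _ => Finset.sum_congr rfl fun y _ => ?_
  rcases (pairChannel_nonneg V u y).eq_or_lt with h | h
  · simp [← h]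
  have hT := cosetChannel_pos (pairChannel_nonneg V) (⊤ : Submodule F (F × F)) h
  have hK := cosetChannel_pos (pairChannel_nonneg V) (LinearMap.ker (LinearMap.snd F F F)) h
  have hq : (1 / Fintype.card F : ℝ) ≠ 0 := by positivity
  rw [law_snd, law_output, law_snd_output, ← cosetChannel_top (F := F) u, ← cosetChannel_ker_snd,
    Real.logb_mul hq hK.ne', Real.logb_div h.ne' hT.ne', Real.logb_div h.ne' hK.ne']
  ring

end Information

/-! ### Lines in the plane of input pairs -/

section Lines

variable {F : Type*} [Field F] {L : Submodule F (F × F)}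

theorem exists_fst_ne_zero (h0 : L ≠ ⊥) (h : L ≠ LinearMap.ker (LinearMap.fst F F F)) :
    ∃ d ∈ L, d.1 ≠ 0 := by
  by_contra! hL
  refine h (le_antisymm (fun d hd => hL d hd) fun v hv => ?_)
  obtain ⟨d, hd, hd0⟩ := L.exists_mem_ne_zero_of_ne_bot h0
  have h1 := hL d hd
  have h2 : d.2 ≠ 0 := fun h2 => hd0 (Prod.ext h1 h2)
  have hv : v.1 = 0 := hv
  have : v = (v.2 / d.2) • d := by
    ext
    · simp [h1, hv]
    · simp [h2]
  rw [this]
  exact L.smul_mem _ hd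

theorem exists_snd_ne_zero (h0 : L ≠ ⊥) (h : L ≠ LinearMap.ker (LinearMap.snd F F F)) :
    ∃ d ∈ L, d.2 ≠ 0 := by
  by_contra! hL
  refine h (le_antisymm (fun d hd => hL d hd) fun v hv => ?_)
  obtain ⟨d, hd, hd0⟩ := L.exists_mem_ne_zero_of_ne_bot h0
  have h1 := hL d hd
  have h2 : d.1 ≠ 0 := fun h2 => hd0 (Prod.ext h2 h1)
  have hv : v.2 = 0 := hv
  have : v = (v.1 / d.1) • d := by
    ext
    · simp [h2]
    · simp [h1, hv]
  rw [this]
  exact L.smul_mem _ hd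

theorem sup_ker_eq_top {U : Type*} [AddCommGroup U] [Module F U] {L : Submodule F U}
    (f : U →ₗ[F] F) (h : ∃ d ∈ L, f d ≠ 0) : L ⊔ LinearMap.ker f = ⊤ := by
  obtain ⟨d, hd, hd0⟩ := h
  refine eq_top_iff.2 fun v _ => Submodule.mem_sup.2
    ⟨(f v / f d) • d, L.smul_mem _ hd, v - (f v / f d) • d, ?_, by abel⟩
  simp [hd0]

open Classical in
/-- The exponential growth rate of the number of message pairs that compete with the true pair by
letters in the same coset of `L`. -/
noncomputable def competitorRate (R₁ R₂ : ℝ) (L : Submodule F (F × F)) : ℝ :=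
  if L = ⊤ then R₁ + R₂ else if L = LinearMap.ker (LinearMap.snd F F F) then R₁
  else if L = LinearMap.ker (LinearMap.fst F F F) then R₂ else min R₁ R₂

/-- The plane and the two axes are the three inequalities of the pentagon. Any other line
complements each axis, and superadditivity then bounds its information below by both `I(U₁; Y)` and
`I(U₂; Y)`. -/
theorem competitorRate_lt_cosetInfo {Y : Type*} [Fintype F] [Fintype Y] {V : F → F → PMF Y}
    {R₁ R₂ : ℝ} (hR : (R₁, R₂) ∈ regionMAC V ∩ regionL V) (h0 : L ≠ ⊥) :
    competitorRate R₁ R₂ L < cosetInfo (Fintype.card F) (pairChannel V) L := by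
  obtain ⟨⟨h1, h2, h3⟩, h4⟩ := hR
  simp only [regionL, Set.mem_ofPred_eq] at h4
  rw [mutualInfo_fst_eq, mutualInfo_snd_eq] at h4
  simp only [condMutualInfo_fst_eq, condMutualInfo_snd_eq, mutualInfo_inputs_eq] at h1 h2 h3
  have hq : (1 : ℝ) < Fintype.card F := by exact_mod_cast Fintype.one_lt_card
  unfold competitorRate
  split_ifs with hT hS hF
  · rwa [hT]
  · rwa [hS]
  · rwa [hF]
  · have hf := cosetInfo_top_le_add hq (pairChannel_nonneg V) (sum_pairChannel V)
      (sup_ker_eq_top (LinearMap.fst F F F) (exists_fst_ne_zero h0 hF))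
    have hs := cosetInfo_top_le_add hq (pairChannel_nonneg V) (sum_pairChannel V)
      (sup_ker_eq_top (LinearMap.snd F F F) (exists_snd_ne_zero h0 hS))
    refine h4.trans_le (max_le ?_ ?_) <;> linarith

end Lines

/-! ### Counting competing messages -/

section Counting

theorem ncard_le_of_snd_determined {α β E X : Type*} [Fintype α] [Fintype E]
    (S : Set (α × β)) {f : β → X} (hf : Function.Injective f) (Ψ : α → E → X)
    (h : ∀ m ∈ S, ∃ e, f m.2 = Ψ m.1 e) : S.ncard ≤ Fintype.card α * Fintype.card E := by
  classical
  rcases S.eq_empty_or_nonempty with rfl | ⟨m₀, hm₀⟩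
  · simp
  have : Nonempty E := (h m₀ hm₀).nonempty
  choose! e he using h
  rw [← Fintype.card_prod, ← Nat.card_eq_fintype_card, ← Set.ncard_univ]
  refine Set.ncard_le_ncard_of_injOn (fun m => (m.1, e m)) (fun _ _ => Set.mem_univ _) ?_
  intro m hm m' hm' hmm
  obtain ⟨h1, h2⟩ := Prod.ext_iff.1 hmm
  dsimp only at h1 h2
  refine Prod.ext h1 (hf ?_)
  rw [he m hm, he m' hm', h1, h2]

theorem ncard_le_of_fst_determined {α β E X : Type*} [Fintype β] [Fintype E]
    (S : Set (α × β)) {f : α → X} (hf : Function.Injective f) (Ψ : β → E → X)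
    (h : ∀ m ∈ S, ∃ e, f m.1 = Ψ m.2 e) : S.ncard ≤ Fintype.card β * Fintype.card E := by
  rw [← Set.ncard_image_of_injective S Prod.swap_injective]
  refine ncard_le_of_snd_determined _ hf Ψ ?_
  rintro _ ⟨m, hm, rfl⟩
  exact h m hm

variable {F V M₁ M₂ : Type*} [Field F] [AddCommGroup V] [Module F V]

/-- The pair of functionals that belongs to a pair of messages. -/
def pairMap (f₁ : M₁ → V →ₗ[F] F) (f₂ : M₂ → V →ₗ[F] F) (m : M₁ × M₂) : V →ₗ[F] F × F :=
  (f₁ m.1).prod (f₂ m.2)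

theorem exists_comp_eq_of_ker_le {U H : Type*} [AddCommGroup U] [Module F U] [AddCommGroup H]
    [Module F H] {f : V →ₗ[F] U} (hf : Function.Surjective f) (g : V →ₗ[F] H)
    (h : LinearMap.ker f ≤ LinearMap.ker g) : ∃ A : U →ₗ[F] H, g = A ∘ₗ f := by
  obtain ⟨s, hs⟩ := f.exists_rightInverse_of_surjective (LinearMap.range_eq_top.2 hf)
  refine ⟨g ∘ₗ s, LinearMap.ext fun v => ?_⟩
  have : v - s (f v) ∈ LinearMap.ker f := by
    have := LinearMap.congr_fun hs (f v)
    simp only [LinearMap.comp_apply, LinearMap.id_apply] at this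
    simp [this]
  simpa [sub_eq_zero] using h this

theorem linearMap_pair_apply (A : F × F →ₗ[F] F) (u : F × F) :
    A u = A (1, 0) * u.1 + A (0, 1) * u.2 := by
  have : u = u.1 • ((1, 0) : F × F) + u.2 • ((0, 1) : F × F) := by ext <;> simp
  conv_lhs => rw [this]
  rw [map_add, map_smul, map_smul, smul_eq_mul, smul_eq_mul, mul_comm, mul_comm u.2]

variable [Fintype F] [Fintype M₁] [Fintype M₂] {f₁ : M₁ → V →ₗ[F] F} {f₂ : M₂ → V →ₗ[F] F}

/-- On the kernel of the sent pair `A ∘ pairMap f₁ f₂ m'` vanishes, so it factors as `B ∘ pairMap f₁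
f₂ m` with one of `q ^ 2` functionals `B`. Given `B`, a nonzero coefficient of `A` expresses one
message of `m'` through the other. -/
theorem ncard_competitors_le (hf₁ : Function.Injective f₁) (hf₂ : Function.Injective f₂)
    {m : M₁ × M₂} (hm : Function.Surjective (pairMap f₁ f₂ m)) {A : F × F →ₗ[F] F}
    {S : Set (M₁ × M₂)}
    (hS : ∀ m' ∈ S, (LinearMap.ker (pairMap f₁ f₂ m)).map (pairMap f₁ f₂ m') ≤ LinearMap.ker A) :
    (A (0, 1) ≠ 0 → S.ncard ≤ Fintype.card M₁ * Fintype.card F ^ 2) ∧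
      (A (1, 0) ≠ 0 → S.ncard ≤ Fintype.card M₂ * Fintype.card F ^ 2) := by
  have key : ∀ m' ∈ S, ∃ e : F × F, ∀ v, A (1, 0) * f₁ m'.1 v + A (0, 1) * f₂ m'.2 v =
      e.1 * f₁ m.1 v + e.2 * f₂ m.2 v := by
    intro m' hm'
    obtain ⟨B, hB⟩ := exists_comp_eq_of_ker_le hm (A ∘ₗ pairMap f₁ f₂ m') fun v hv =>
      hS m' hm' (Submodule.mem_map_of_mem hv)
    refine ⟨(B (1, 0), B (0, 1)), fun v => ?_⟩
    have := LinearMap.congr_fun hB v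
    rw [LinearMap.comp_apply, LinearMap.comp_apply, linearMap_pair_apply A,
      linearMap_pair_apply B] at this
    exact this
  have hcard : Fintype.card F ^ 2 = Fintype.card (F × F) := by rw [Fintype.card_prod, sq]
  rw [hcard]
  constructor
  · intro h
    refine ncard_le_of_snd_determined S hf₂ (fun m₁ e => (A (0, 1))⁻¹ •
      (e.1 • f₁ m.1 + e.2 • f₂ m.2 - A (1, 0) • f₁ m₁)) fun m' hm' => ?_
    obtain ⟨e, he⟩ := key m' hm'
    refine ⟨e, LinearMap.ext fun v => ?_⟩
    simp only [LinearMap.smul_apply, LinearMap.sub_apply, LinearMap.add_apply, smul_eq_mul,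
      ← he v]
    field_simp
    ring
  · intro h
    refine ncard_le_of_fst_determined S hf₁ (fun m₂ e => (A (1, 0))⁻¹ •
      (e.1 • f₁ m.1 + e.2 • f₂ m.2 - A (0, 1) • f₂ m₂)) fun m' hm' => ?_
    obtain ⟨e, he⟩ := key m' hm'
    refine ⟨e, LinearMap.ext fun v => ?_⟩
    simp only [LinearMap.smul_apply, LinearMap.sub_apply, LinearMap.add_apply, smul_eq_mul,
      ← he v]
    field_simp
    ring

theorem card_pow_ceil_le {q x : ℝ} (hq : 1 < q) (hx : 0 ≤ x) : q ^ ⌈x⌉₊ ≤ q * q ^ x := by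
  have hq0 : 0 < q := by linarith
  rw [← Real.rpow_natCast, mul_comm, ← Real.rpow_add_one hq0.ne']
  exact Real.rpow_le_rpow_of_exponent_le hq.le (Nat.ceil_lt_add_one hx).le

/-- In `q ^ 3` one factor pays for rounding up the message length and `q ^ 2` for the choice of `B`
above. For `L = ⊤` only two roundings occur. -/
theorem ncard_competitors_le_rpow (hf₁ : Function.Injective f₁) (hf₂ : Function.Injective f₂)
    {R₁ R₂ : ℝ} (hR₁ : 0 ≤ R₁) (hR₂ : 0 ≤ R₂) {n : ℕ}
    (hM₁ : Fintype.card M₁ = Fintype.card F ^ ⌈n * R₁⌉₊)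
    (hM₂ : Fintype.card M₂ = Fintype.card F ^ ⌈n * R₂⌉₊)
    {m : M₁ × M₂} (hm : Function.Surjective (pairMap f₁ f₂ m)) (good : Set (M₁ × M₂))
    {L : Submodule F (F × F)} (hL : L ≠ ⊥) :
    (Set.ncard {m' ∈ good | (LinearMap.ker (pairMap f₁ f₂ m)).map (pairMap f₁ f₂ m') = L} : ℝ) ≤
      (Fintype.card F : ℝ) ^ 3 * (Fintype.card F : ℝ) ^ (n * competitorRate R₁ R₂ L) := by
  set S := {m' ∈ good | (LinearMap.ker (pairMap f₁ f₂ m)).map (pairMap f₁ f₂ m') = L}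
  set q : ℝ := (Fintype.card F : ℝ) with hqdef
  have hq : 1 < q := by rw [hqdef]; exact_mod_cast Fintype.one_lt_card
  have hq0 : 0 < q := by linarith
  have h1 : (Fintype.card M₁ : ℝ) ≤ q * q ^ (n * R₁) := by
    rw [hM₁]; push_cast; exact card_pow_ceil_le hq (by positivity)
  have h2 : (Fintype.card M₂ : ℝ) ≤ q * q ^ (n * R₂) := by
    rw [hM₂]; push_cast; exact card_pow_ceil_le hq (by positivity)
  by_cases hT : L = ⊤
  · rw [competitorRate, if_pos hT]
    calc (S.ncard : ℝ) ≤ (Fintype.card M₁ : ℝ) * Fintype.card M₂ := by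
          rw [← Nat.cast_mul, ← Fintype.card_prod, ← Nat.card_eq_fintype_card, ← Set.ncard_univ]
          exact_mod_cast Set.ncard_le_ncard (Set.subset_univ S)
      _ ≤ (q * q ^ (n * R₁)) * (q * q ^ (n * R₂)) := by gcongr
      _ = q ^ 2 * q ^ (n * (R₁ + R₂)) := by rw [mul_add, Real.rpow_add hq0]; ring
      _ ≤ _ := by gcongr <;> first | exact hq.le | norm_num
  obtain ⟨A, hA0, hA⟩ := Submodule.exists_le_ker_of_lt_top L (lt_top_iff_ne_top.2 hT)
  obtain ⟨hc1, hc2⟩ := ncard_competitors_le hf₁ hf₂ hm (S := S) (A := A) fun m' hm' =>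
    hm'.2.le.trans hA
  have hA0' : A (1, 0) = 0 → A (0, 1) = 0 → False := fun h1 h2 => hA0 <| LinearMap.ext fun u => by
    rw [linearMap_pair_apply, h1, h2]; simp
  have hb1 : A (0, 1) ≠ 0 → (S.ncard : ℝ) ≤ q ^ 3 * q ^ (n * R₁) := fun h => by
    calc (S.ncard : ℝ) ≤ (Fintype.card M₁ : ℝ) * q ^ 2 := by rw [hqdef]; exact_mod_cast hc1 h
      _ ≤ q * q ^ (n * R₁) * q ^ 2 := by gcongr
      _ = _ := by ring
  have hb2 : A (1, 0) ≠ 0 → (S.ncard : ℝ) ≤ q ^ 3 * q ^ (n * R₂) := fun h => by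
    calc (S.ncard : ℝ) ≤ (Fintype.card M₂ : ℝ) * q ^ 2 := by rw [hqdef]; exact_mod_cast hc2 h
      _ ≤ q * q ^ (n * R₂) * q ^ 2 := by gcongr
      _ = _ := by ring
  rw [competitorRate, if_neg hT]
  split_ifs with hS hF
  · refine hb1 fun h => hA0' (hA ?_) h
    simp [hS]
  · refine hb2 fun h => hA0' h (hA ?_)
    simp [hF]
  -- On an oblique line both coefficients of `A` are nonzero, so either message determines the other
  -- and the smaller count is available.
  · have hA1 : A (1, 0) ≠ 0 := fun h => by
      obtain ⟨d, hd, hd0⟩ := exists_snd_ne_zero hL hS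
      have := hA hd
      rw [LinearMap.mem_ker, linearMap_pair_apply, h, zero_mul, zero_add] at this
      exact hA0' h ((mul_eq_zero.1 this).resolve_right hd0)
    have hA2 : A (0, 1) ≠ 0 := fun h => by
      obtain ⟨d, hd, hd0⟩ := exists_fst_ne_zero hL hF
      have := hA hd
      rw [LinearMap.mem_ker, linearMap_pair_apply, h, zero_mul, add_zero] at this
      exact hA0' ((mul_eq_zero.1 this).resolve_right hd0) h
    rcases min_choice R₁ R₂ with h | h <;> rw [h]
    · exact hb1 hA2
    · exact hb2 hA1

end Counting

/-! ### Random coset codes -/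

section Codes

variable {F X₁ X₂ Y : Type*} [Field F]

/-- The functional that maps a column of the generator matrix to the corresponding letter of the
codeword of the message `m`. -/
def padFunctional {k : ℕ} (κ : ℕ) (m : Fin k → F) : (Fin κ → F) →ₗ[F] F :=
  ∑ i, zeroPad κ m i • LinearMap.proj i

theorem padFunctional_apply {k κ : ℕ} (m : Fin k → F) (g : Fin κ → F) :
    padFunctional κ m g = zeroPad κ m ⬝ᵥ g := by
  simp [padFunctional, dotProduct]

theorem zeroPad_injective {k κ : ℕ} (h : k ≤ κ) :
    Function.Injective (zeroPad κ : (Fin k → F) → Fin κ → F) := by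
  intro m m' hm
  funext i
  simpa [zeroPad] using congr_fun hm ⟨i, i.2.trans_le h⟩

theorem padFunctional_injective {k κ : ℕ} (h : k ≤ κ) :
    Function.Injective (padFunctional κ : (Fin k → F) → (Fin κ → F) →ₗ[F] F) := by
  intro m m' hm
  refine zeroPad_injective h (funext fun i => ?_)
  simpa [padFunctional_apply] using LinearMap.congr_fun hm (Pi.single i 1)

theorem padFunctional_smul_add_smul {k κ : ℕ} (a b : F) (m m' : Fin k → F) :
    padFunctional κ (a • m + b • m') = a • padFunctional κ m + b • padFunctional κ m' := by
  have : zeroPad κ (a • m + b • m') = a • zeroPad κ m + b • zeroPad κ m' := by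
    funext i
    by_cases h : i.1 < k <;> simp [zeroPad, h]
  refine LinearMap.ext fun g => ?_
  simp [padFunctional_apply, this, add_dotProduct]

theorem sum_error_eq [Fintype F] [Fintype Y] (W : X₁ → X₂ → PMF Y) (φ₁ : F → X₁) (φ₂ : F → X₂)
    {V : Type*} [AddCommGroup V] [Module F V] {k₁ k₂ n : ℕ}
    (G : Matrix (Fin (max k₁ k₂)) (Fin n) F) (d₁ d₂ : Fin n → F)
    (dec : (Fin n → Y) → (Fin k₁ → F) × (Fin k₂ → F))
    (f₁ : (Fin k₁ → F) → V →ₗ[F] F) (f₂ : (Fin k₂ → F) → V →ₗ[F] F) (g : Fin n → V)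
    (h₁ : ∀ m i, f₁ m (g i) = codeword G d₁ m i) (h₂ : ∀ m i, f₂ m (g i) = codeword G d₂ m i) :
    cosetError W φ₁ φ₂ G d₁ d₂ dec =
      imageError (pairChannel (virtualChannel W φ₁ φ₂)) (pairMap f₁ f₂) g dec := by
  classical
  rw [imageError, ← Finset.univ_product_univ, Finset.expect_product]
  refine Finset.expect_congr rfl fun m₁ _ => Finset.expect_congr rfl fun m₂ _ =>
    Finset.sum_congr rfl fun y _ => ?_
  by_cases h : dec y = (m₁, m₂)
  · rw [if_pos h, if_pos h]
  · rw [if_neg h, if_neg h]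
    refine Finset.prod_congr rfl fun i _ => ?_
    beta_reduce
    rw [← h₁, ← h₂]
    rfl

theorem cosetError_nonneg [Fintype F] [Fintype Y] (W : X₁ → X₂ → PMF Y) (φ₁ : F → X₁)
    (φ₂ : F → X₂) {k₁ k₂ n : ℕ} (G : Matrix (Fin (max k₁ k₂)) (Fin n) F) (d₁ d₂ : Fin n → F)
    (dec : (Fin n → Y) → (Fin k₁ → F) × (Fin k₂ → F)) : 0 ≤ cosetError W φ₁ φ₂ G d₁ d₂ dec := by
  refine Finset.expect_nonneg fun m₁ _ => Finset.expect_nonneg fun m₂ _ =>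
    Finset.sum_nonneg fun y _ => ?_
  split_ifs
  · exact le_rfl
  · exact Finset.prod_nonneg fun i _ => ENNReal.toReal_nonneg

/-- The columns of the generator matrix, each with the corresponding letters of the coset
leaders. -/
def columnEquiv (F : Type*) (κ n : ℕ) :
    Matrix (Fin κ) (Fin n) F × (Fin n → F) × (Fin n → F) ≃ (Fin n → (Fin κ → F) × F × F) where
  toFun x i := (fun j => x.1 j i, x.2.1 i, x.2.2 i)
  invFun g := (fun j i => (g i).1 j, fun i => (g i).2.1, fun i => (g i).2.2)
  left_inv _ := rfl
  right_inv _ := rfl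

/-- The functional that maps a column of the generator matrix and the corresponding letters of the
two coset leaders to the letter of the first codeword of the message `m`. -/
def cosetFunctional₁ {k : ℕ} (κ : ℕ) (m : Fin k → F) : ((Fin κ → F) × F × F) →ₗ[F] F :=
  padFunctional κ m ∘ₗ LinearMap.fst F _ _ + LinearMap.fst F F F ∘ₗ LinearMap.snd F _ _

/-- The functional that maps a column of the generator matrix and the corresponding letters of the
two coset leaders to the letter of the second codeword of the message `m`. -/
def cosetFunctional₂ {k : ℕ} (κ : ℕ) (m : Fin k → F) : ((Fin κ → F) × F × F) →ₗ[F] F :=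
  padFunctional κ m ∘ₗ LinearMap.fst F _ _ + LinearMap.snd F F F ∘ₗ LinearMap.snd F _ _

theorem cosetFunctional₁_apply {k κ : ℕ} (m : Fin k → F) (v : (Fin κ → F) × F × F) :
    cosetFunctional₁ κ m v = zeroPad κ m ⬝ᵥ v.1 + v.2.1 := by
  simp [cosetFunctional₁, padFunctional_apply]

theorem cosetFunctional₂_apply {k κ : ℕ} (m : Fin k → F) (v : (Fin κ → F) × F × F) :
    cosetFunctional₂ κ m v = zeroPad κ m ⬝ᵥ v.1 + v.2.2 := by
  simp [cosetFunctional₂, padFunctional_apply]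

theorem cosetFunctional₁_injective {k κ : ℕ} (h : k ≤ κ) :
    Function.Injective (cosetFunctional₁ κ : (Fin k → F) → _ →ₗ[F] F) := fun m m' hm =>
  padFunctional_injective h <| LinearMap.ext fun g => by
    simpa [cosetFunctional₁_apply, padFunctional_apply] using LinearMap.congr_fun hm (g, 0, 0)

theorem cosetFunctional₂_injective {k κ : ℕ} (h : k ≤ κ) :
    Function.Injective (cosetFunctional₂ κ : (Fin k → F) → _ →ₗ[F] F) := fun m m' hm =>
  padFunctional_injective h <| LinearMap.ext fun g => by
    simpa [cosetFunctional₂_apply, padFunctional_apply] using LinearMap.congr_fun hm (g, 0, 0)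

/-- The coset leaders alone already produce every pair of letters, whatever the messages are. -/
theorem pairMap_cosetFunctional_surjective {k₁ k₂ κ : ℕ} (m : (Fin k₁ → F) × (Fin k₂ → F)) :
    Function.Surjective (pairMap (cosetFunctional₁ κ) (cosetFunctional₂ κ) m) := fun u =>
  ⟨(0, u.1, u.2), by simp [pairMap, cosetFunctional₁_apply, cosetFunctional₂_apply]⟩

/-- Any column `g` extends to an element of the kernel by choosing leader letters that cancel the
letters of `m`. Its image under `m'` consists of the differences of the two codes' letters, and
these vanish for all `g` only if the messages agree. -/
theorem eq_of_map_ker_cosetFunctional_eq_bot {k₁ k₂ κ : ℕ} (h₁ : k₁ ≤ κ) (h₂ : k₂ ≤ κ)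
    {m m' : (Fin k₁ → F) × (Fin k₂ → F)}
    (h : (LinearMap.ker (pairMap (cosetFunctional₁ κ) (cosetFunctional₂ κ) m)).map
      (pairMap (cosetFunctional₁ κ) (cosetFunctional₂ κ) m') = ⊥) : m' = m := by
  have hk : ∀ g : Fin κ → F, zeroPad κ m'.1 ⬝ᵥ g = zeroPad κ m.1 ⬝ᵥ g ∧
      zeroPad κ m'.2 ⬝ᵥ g = zeroPad κ m.2 ⬝ᵥ g := by
    intro g
    have hmem : (g, -(zeroPad κ m.1 ⬝ᵥ g), -(zeroPad κ m.2 ⬝ᵥ g)) ∈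
        LinearMap.ker (pairMap (cosetFunctional₁ κ) (cosetFunctional₂ κ) m) := by
      simp [pairMap, cosetFunctional₁_apply, cosetFunctional₂_apply]
    have := Submodule.mem_map_of_mem
      (f := pairMap (cosetFunctional₁ κ) (cosetFunctional₂ κ) m') hmem
    rw [h] at this
    simpa [pairMap, cosetFunctional₁_apply, cosetFunctional₂_apply, add_neg_eq_zero] using this
  exact Prod.ext
    (padFunctional_injective h₁ <| LinearMap.ext fun g => by
      simpa [padFunctional_apply] using (hk g).1)
    (padFunctional_injective h₂ <| LinearMap.ext fun g => by
      simpa [padFunctional_apply] using (hk g).2)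

variable [Fintype F] [Fintype Y]

theorem expect_cosetError_eq (W : X₁ → X₂ → PMF Y) (φ₁ : F → X₁) (φ₂ : F → X₂) {k₁ k₂ n : ℕ}
    (dec : (Fin n → (Fin (max k₁ k₂) → F) × F × F) → (Fin n → Y) →
      (Fin k₁ → F) × (Fin k₂ → F)) :
    𝔼 G : Matrix (Fin (max k₁ k₂)) (Fin n) F, 𝔼 d₁ : Fin n → F, 𝔼 d₂ : Fin n → F,
      cosetError W φ₁ φ₂ G d₁ d₂ (dec (columnEquiv F (max k₁ k₂) n (G, d₁, d₂))) =
    𝔼 g : Fin n → (Fin (max k₁ k₂) → F) × F × F,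
      imageError (pairChannel (virtualChannel W φ₁ φ₂))
        (pairMap (cosetFunctional₁ (max k₁ k₂)) (cosetFunctional₂ (max k₁ k₂))) g (dec g) := by
  classical
  rw [← Fintype.expect_equiv (columnEquiv F (max k₁ k₂) n) _ _ fun _ => rfl,
    ← Finset.univ_product_univ, Finset.expect_product]
  refine Finset.expect_congr rfl fun G _ => ?_
  rw [← Finset.univ_product_univ, Finset.expect_product]
  refine Finset.expect_congr rfl fun d₁ _ => Finset.expect_congr rfl fun d₂ _ => ?_
  exact sum_error_eq W φ₁ φ₂ G d₁ d₂ _ _ _ _ (fun m i => cosetFunctional₁_apply m _)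
    fun m i => cosetFunctional₂_apply m _

theorem achievableByRandomCosetCodes_of_mem (W : X₁ → X₂ → PMF Y) (φ₁ : F → X₁) (φ₂ : F → X₂)
    (R₁ R₂ : ℝ) (hR₁ : 0 ≤ R₁) (hR₂ : 0 ≤ R₂)
    (hR : (R₁, R₂) ∈
      regionMAC (virtualChannel W φ₁ φ₂) ∩ regionL (virtualChannel W φ₁ φ₂)) :
    AchievableByRandomCosetCodes W φ₁ φ₂ R₁ R₂ := by
  classical
  have hq : (1 : ℝ) < Fintype.card F := by exact_mod_cast Fintype.one_lt_card
  have := Fintype.ofFinite (Submodule F (F × F))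
  obtain ⟨B, hB, hdec⟩ := exists_vanishing_error hq
    (pairChannel_nonneg (virtualChannel W φ₁ φ₂)) (sum_pairChannel (virtualChannel W φ₁ φ₂))
    {L : Submodule F (F × F) | L ≠ ⊥} (competitorRate R₁ R₂)
    -- No linear maps `A` are needed: with random leaders no other message is determined by the sent
    -- codeword.
    (fun L hL => competitorRate_lt_cosetInfo hR (by simpa using hL)) ∅ (by simp)
    ((Fintype.card F : ℝ) ^ 3)
  have hdec' := fun n : ℕ => hdec n ((Fin (max ⌈n * R₁⌉₊ ⌈n * R₂⌉₊) → F) × F × F)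
    ((Fin ⌈n * R₁⌉₊ → F) × (Fin ⌈n * R₂⌉₊ → F))
    (pairMap (cosetFunctional₁ _) (cosetFunctional₂ _)) Set.univ
    (fun m _ => pairMap_cosetFunctional_surjective m)
    (fun m _ L hL => ncard_competitors_le_rpow (cosetFunctional₁_injective (le_max_left _ _))
      (cosetFunctional₂_injective (le_max_right _ _)) hR₁ hR₂ (by simp) (by simp)
      (pairMap_cosetFunctional_surjective m) _ (by simpa using hL))
    (fun m _ m' _ hne => Or.inl <| Finset.mem_filter.2 ⟨Finset.mem_univ _, fun h =>
      hne (eq_of_map_ker_cosetFunctional_eq_bot (le_max_left _ _) (le_max_right _ _) h)⟩)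
  choose dec hdec' using hdec'
  refine ⟨fun n G d₁ d₂ => dec n (columnEquiv F _ n (G, d₁, d₂)), ?_⟩
  refine squeeze_zero (fun n => Finset.expect_nonneg fun G _ => Finset.expect_nonneg fun d₁ _ =>
    Finset.expect_nonneg fun d₂ _ => cosetError_nonneg W φ₁ φ₂ G d₁ d₂ _) (fun n => ?_) hB
  have h := hdec' n
  rw [Set.compl_univ, Set.ncard_empty, Nat.cast_zero, zero_div, zero_add] at h
  rwa [expect_cosetError_eq]

end Codes

/-! ### Random linear codes -/

section Linear

variable {F V M₁ M₂ : Type*} [Field F] [AddCommGroup V] [Module F V]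

/-- The message pairs that are linearly independent, and where the message of the sender with the
higher rate is not a possible message of the other sender. -/
def goodPairs (R₁ R₂ : ℝ) (f₁ : M₁ → V →ₗ[F] F) (f₂ : M₂ → V →ₗ[F] F) : Set (M₁ × M₂) :=
  {m | Function.Surjective (pairMap f₁ f₂ m) ∧ (R₁ < R₂ → ∀ m₁, f₂ m.2 ≠ f₁ m₁) ∧
    (R₂ < R₁ → ∀ m₂, f₁ m.1 ≠ f₂ m₂)}

/-- The linear maps, other than the identity, that can turn a message pair into another one. -/
def competingMaps (F : Type*) [Field F] (R₁ R₂ : ℝ) : Set (F × F →ₗ[F] F × F) :=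
  {A | A ≠ LinearMap.id ∧ (R₁ < R₂ → (A (0, 1)).1 = 0) ∧ (R₂ < R₁ → (A (1, 0)).2 = 0)}

theorem linearMap_prod_apply (A : F × F →ₗ[F] F × F) (u : F × F) :
    A u = ((A (1, 0)).1 * u.1 + (A (0, 1)).1 * u.2, (A (1, 0)).2 * u.1 + (A (0, 1)).2 * u.2) :=
  Prod.ext (linearMap_pair_apply (LinearMap.fst F F F ∘ₗ A) u)
    (linearMap_pair_apply (LinearMap.snd F F F ∘ₗ A) u)

theorem exists_ne_of_mem_competingMaps {Y : Type*} {R₁ R₂ : ℝ} {W : F → F → PMF Y}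
    (h : ¬ HasLinearAmbiguity W R₁ R₂) {A : F × F →ₗ[F] F × F} (hA : A ∈ competingMaps F R₁ R₂) :
    ∃ u, pairChannel W (A u) ≠ pairChannel W u := by
  by_contra! hu
  refine h ⟨(A (1, 0)).1, (A (0, 1)).1, (A (1, 0)).2, (A (0, 1)).2, ?_, hA.2.1, hA.2.2, ?_⟩
  · rintro ⟨h1, h2, h3, h4⟩
    refine hA.1 (LinearMap.ext fun u => ?_)
    rw [linearMap_prod_apply, h1, h2, h3, h4]
    simp
  · intro u₁ u₂
    refine PMF.ext fun y => ?_
    have := congr_fun (hu (u₁, u₂)) y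
    rw [linearMap_prod_apply] at this
    exact (ENNReal.toReal_eq_toReal_iff' (PMF.apply_ne_top _ _) (PMF.apply_ne_top _ _)).1 this

/-- Type `⊥` means that the competitor factors through the sent pair. If `R₁ < R₂` and the
coefficient of the second letter in the first were nonzero, the first row could be solved for `f₂
m.2`, placing it in the range of `f₁`; goodness forbids this. The other case is symmetric. -/
theorem exists_mem_competingMaps {R₁ R₂ : ℝ} {f₁ : M₁ → V →ₗ[F] F} {f₂ : M₂ → V →ₗ[F] F}
    (hf₁ : Function.Injective f₁) (hf₂ : Function.Injective f₂)
    (hlin₁ : ∀ (a b : F) m m', ∃ m'', f₁ m'' = a • f₁ m + b • f₁ m')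
    (hlin₂ : ∀ (a b : F) m m', ∃ m'', f₂ m'' = a • f₂ m + b • f₂ m')
    {m m' : M₁ × M₂} (hm : m ∈ goodPairs R₁ R₂ f₁ f₂) (hne : m' ≠ m)
    (h : (LinearMap.ker (pairMap f₁ f₂ m)).map (pairMap f₁ f₂ m') = ⊥) :
    ∃ A ∈ competingMaps F R₁ R₂, pairMap f₁ f₂ m' = A ∘ₗ pairMap f₁ f₂ m := by
  obtain ⟨A, hA⟩ := exists_comp_eq_of_ker_le hm.1 (pairMap f₁ f₂ m')
    (LinearMap.le_ker_iff_map.2 h)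
  have hv : ∀ v, (f₁ m'.1 v, f₂ m'.2 v) = A (f₁ m.1 v, f₂ m.2 v) := LinearMap.congr_fun hA
  refine ⟨A, ⟨?_, fun hR => ?_, fun hR => ?_⟩, hA⟩
  · rintro rfl
    exact hne (Prod.ext (hf₁ (LinearMap.ext fun v => (Prod.ext_iff.1 (hv v)).1))
      (hf₂ (LinearMap.ext fun v => (Prod.ext_iff.1 (hv v)).2)))
  · by_contra hb
    obtain ⟨m'', hm''⟩ := hlin₁ ((A (0, 1)).1)⁻¹ (-(((A (0, 1)).1)⁻¹ * (A (1, 0)).1)) m'.1 m.1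
    refine hm.2.1 hR m'' (LinearMap.ext fun v => ?_)
    have := hv v
    rw [linearMap_prod_apply] at this
    have := (Prod.ext_iff.1 this).1
    dsimp only at this
    rw [hm'']
    simp only [LinearMap.add_apply, LinearMap.smul_apply, smul_eq_mul, this]
    field_simp
    ring
  · by_contra hb
    obtain ⟨m'', hm''⟩ := hlin₂ ((A (1, 0)).2)⁻¹ (-(((A (1, 0)).2)⁻¹ * (A (0, 1)).2)) m'.2 m.2
    refine hm.2.2 hR m'' (LinearMap.ext fun v => ?_)
    have := hv v
    rw [linearMap_prod_apply] at this
    have := (Prod.ext_iff.1 this).2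
    dsimp only at this
    rw [hm'']
    simp only [LinearMap.add_apply, LinearMap.smul_apply, smul_eq_mul, this]
    field_simp
    ring

variable [Fintype F] [Fintype M₁] [Fintype M₂]

-- A pair that is not surjective is linearly dependent, so one message is one of at most `q`
-- multiples of the other. If the longer message lies in the code of the shorter, it is fixed by a
-- single shorter message.
open Classical in
theorem ncard_compl_goodPairs_le (R₁ R₂ : ℝ) {f₁ : M₁ → V →ₗ[F] F} {f₂ : M₂ → V →ₗ[F] F}
    (hf₁ : Function.Injective f₁) (hf₂ : Function.Injective f₂) :
    (goodPairs R₁ R₂ f₁ f₂)ᶜ.ncard ≤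
      Fintype.card M₁ * Fintype.card F + Fintype.card M₂ * Fintype.card F +
      (if R₁ < R₂ then Fintype.card M₁ * Fintype.card M₁ else 0) +
      (if R₂ < R₁ then Fintype.card M₂ * Fintype.card M₂ else 0) := by
  set S₁ : Set (M₁ × M₂) := {m | ∃ e : F, f₂ m.2 = e • f₁ m.1}
  set S₂ : Set (M₁ × M₂) := {m | ∃ e : F, f₁ m.1 = e • f₂ m.2}
  set S₃ : Set (M₁ × M₂) := {m | R₁ < R₂ ∧ ∃ m₁, f₂ m.2 = f₁ m₁}
  set S₄ : Set (M₁ × M₂) := {m | R₂ < R₁ ∧ ∃ m₂, f₁ m.1 = f₂ m₂}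
  have hsub : (goodPairs R₁ R₂ f₁ f₂)ᶜ ⊆ S₁ ∪ S₂ ∪ S₃ ∪ S₄ := by
    intro m hm
    by_contra hS
    simp only [Set.mem_union, not_or] at hS
    obtain ⟨⟨⟨h1, h2⟩, h3⟩, h4⟩ := hS
    refine hm ⟨?_, fun hR m₁ h => h3 ⟨hR, m₁, h⟩, fun hR m₂ h => h4 ⟨hR, m₂, h⟩⟩
    by_contra hsurj
    rw [← LinearMap.range_eq_top] at hsurj
    obtain ⟨A, hA0, hA⟩ := Submodule.exists_le_ker_of_lt_top _ (lt_top_iff_ne_top.2 hsurj)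
    have hv : ∀ v, A (1, 0) * f₁ m.1 v + A (0, 1) * f₂ m.2 v = 0 := fun v => by
      have : A (pairMap f₁ f₂ m v) = 0 := hA (LinearMap.mem_range_self _ v)
      rwa [linearMap_pair_apply] at this
    by_cases hb : A (0, 1) = 0
    · have ha : A (1, 0) ≠ 0 := fun ha => hA0 <| LinearMap.ext fun u => by
        rw [linearMap_pair_apply, ha, hb]; simp
      refine h2 ⟨0, LinearMap.ext fun v => ?_⟩
      have := hv v
      rw [hb, zero_mul, add_zero] at this
      simpa using (mul_eq_zero.1 this).resolve_left ha
    · refine h1 ⟨-((A (0, 1))⁻¹ * A (1, 0)), LinearMap.ext fun v => ?_⟩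
      simp only [LinearMap.smul_apply, smul_eq_mul]
      field_simp
      linear_combination hv v
  have h1 : S₁.ncard ≤ Fintype.card M₁ * Fintype.card F :=
    ncard_le_of_snd_determined S₁ hf₂ (fun m₁ e => e • f₁ m₁) fun m hm => hm
  have h2 : S₂.ncard ≤ Fintype.card M₂ * Fintype.card F :=
    ncard_le_of_fst_determined S₂ hf₁ (fun m₂ e => e • f₂ m₂) fun m hm => hm
  have h3 : S₃.ncard ≤ if R₁ < R₂ then Fintype.card M₁ * Fintype.card M₁ else 0 := by
    split_ifs with h
    · exact ncard_le_of_snd_determined S₃ hf₂ (fun _ e => f₁ e) fun m hm => hm.2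
    · simp [S₃, h]
  have h4 : S₄.ncard ≤ if R₂ < R₁ then Fintype.card M₂ * Fintype.card M₂ else 0 := by
    split_ifs with h
    · exact ncard_le_of_fst_determined S₄ hf₁ (fun _ e => f₂ e) fun m hm => hm.2
    · simp [S₄, h]
  calc _ ≤ (S₁ ∪ S₂ ∪ S₃ ∪ S₄).ncard := Set.ncard_le_ncard hsub
    _ ≤ S₁.ncard + S₂.ncard + S₃.ncard + S₄.ncard := by
        refine (Set.ncard_union_le _ _).trans (Nat.add_le_add_right ?_ _)
        refine (Set.ncard_union_le _ _).trans (Nat.add_le_add_right ?_ _)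
        exact Set.ncard_union_le _ _
    _ ≤ _ := by gcongr

open Classical in
/-- An upper bound, which tends to zero, on the fraction of message pairs that are not good. -/
noncomputable def badFraction (q R₁ R₂ : ℝ) (n : ℕ) : ℝ :=
  q * (q ^ (-R₂)) ^ n + q * (q ^ (-R₁)) ^ n + (if R₁ < R₂ then q * (q ^ (R₁ - R₂)) ^ n else 0) +
    (if R₂ < R₁ then q * (q ^ (R₂ - R₁)) ^ n else 0)

theorem tendsto_badFraction {q R₁ R₂ : ℝ} (hq : 1 < q) (hR₁ : 0 < R₁) (hR₂ : 0 < R₂) :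
    Filter.Tendsto (badFraction q R₁ R₂) Filter.atTop (𝓝 0) := by
  have key : ∀ x : ℝ, x < 0 →
      Filter.Tendsto (fun n : ℕ => q * (q ^ x) ^ n) Filter.atTop (𝓝 0) := fun x hx => by
    rw [← mul_zero q]
    exact (tendsto_pow_atTop_nhds_zero_of_lt_one (by positivity)
      (Real.rpow_lt_one_of_one_lt_of_neg hq hx)).const_mul q
  have key' : ∀ (P : Prop) [Decidable P] (x : ℝ), (P → x < 0) →
      Filter.Tendsto (fun n : ℕ => if P then q * (q ^ x) ^ n else 0) Filter.atTop (𝓝 0) :=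
    fun P _ x hx => by
      by_cases hP : P
      · simpa only [if_pos hP] using key x (hx hP)
      · simpa only [if_neg hP] using tendsto_const_nhds
  have := (((key (-R₂) (by linarith)).add (key (-R₁) (by linarith))).add
    (key' (R₁ < R₂) (R₁ - R₂) sub_neg.2)).add (key' (R₂ < R₁) (R₂ - R₁) sub_neg.2)
  simp only [add_zero] at this
  refine this.congr fun n => ?_
  simp only [badFraction]

/-- Rounding up costs at most a factor `q` in each numerator and nothing in the denominators. -/
theorem ncard_compl_goodPairs_div_le {R₁ R₂ : ℝ} (hR₁ : 0 ≤ R₁) (hR₂ : 0 ≤ R₂) {n : ℕ}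
    {f₁ : M₁ → V →ₗ[F] F} {f₂ : M₂ → V →ₗ[F] F}
    (hf₁ : Function.Injective f₁) (hf₂ : Function.Injective f₂)
    (hM₁ : Fintype.card M₁ = Fintype.card F ^ ⌈n * R₁⌉₊)
    (hM₂ : Fintype.card M₂ = Fintype.card F ^ ⌈n * R₂⌉₊) :
    ((goodPairs R₁ R₂ f₁ f₂)ᶜ.ncard : ℝ) / Fintype.card (M₁ × M₂) ≤
      badFraction (Fintype.card F) R₁ R₂ n := by
  have hc := ncard_compl_goodPairs_le R₁ R₂ hf₁ hf₂
  set q : ℝ := (Fintype.card F : ℝ) with hqdef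
  have hq : 1 < q := by rw [hqdef]; exact_mod_cast Fintype.one_lt_card
  have hq0 : 0 < q := by linarith
  have lower : ∀ R : ℝ, q ^ (n * R) ≤ q ^ ⌈n * R⌉₊ := fun R => by
    rw [← Real.rpow_natCast]
    exact Real.rpow_le_rpow_of_exponent_le hq.le (Nat.le_ceil _)
  have hm₁ : (Fintype.card M₁ : ℝ) = q ^ ⌈n * R₁⌉₊ := by rw [hM₁]; push_cast; rfl
  have hm₂ : (Fintype.card M₂ : ℝ) = q ^ ⌈n * R₂⌉₊ := by rw [hM₂]; push_cast; rfl
  have u₁ : (Fintype.card M₁ : ℝ) ≤ q * q ^ (n * R₁) :=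
    hm₁ ▸ card_pow_ceil_le hq (by positivity)
  have u₂ : (Fintype.card M₂ : ℝ) ≤ q * q ^ (n * R₂) :=
    hm₂ ▸ card_pow_ceil_le hq (by positivity)
  have l₁ : q ^ (n * R₁) ≤ (Fintype.card M₁ : ℝ) := hm₁ ▸ lower R₁
  have l₂ : q ^ (n * R₂) ≤ (Fintype.card M₂ : ℝ) := hm₂ ▸ lower R₂
  have p₁ : (0 : ℝ) < Fintype.card M₁ := by rw [hm₁]; positivity
  have p₂ : (0 : ℝ) < Fintype.card M₂ := by rw [hm₂]; positivity
  have inv : ∀ R : ℝ, (q ^ (-R)) ^ n = (q ^ (n * R))⁻¹ := fun R => by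
    rw [← Real.rpow_mul_natCast hq0.le, ← Real.rpow_neg hq0.le]
    ring_nf
  have ratio : ∀ R R' : ℝ, q * (q ^ (R - R')) ^ n = q * q ^ (n * R) / q ^ (n * R') := fun R R' => by
    rw [← Real.rpow_mul_natCast hq0.le, mul_div_assoc, ← Real.rpow_sub hq0]
    ring_nf
  have hc' : ((goodPairs R₁ R₂ f₁ f₂)ᶜ.ncard : ℝ) ≤
      Fintype.card M₁ * q + Fintype.card M₂ * q +
      (if R₁ < R₂ then (Fintype.card M₁ * Fintype.card M₁ : ℝ) else 0) +
      (if R₂ < R₁ then (Fintype.card M₂ * Fintype.card M₂ : ℝ) else 0) := by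
    rw [hqdef]; exact_mod_cast hc
  rw [Fintype.card_prod, Nat.cast_mul]
  refine (div_le_div_of_nonneg_right hc' (by positivity)).trans ?_
  rw [add_div, add_div, add_div, badFraction]
  refine add_le_add (add_le_add (add_le_add ?_ ?_) ?_) ?_
  · rw [inv, mul_div_mul_left _ _ p₁.ne', div_eq_mul_inv]
    gcongr
  · rw [inv, mul_comm (Fintype.card M₁ : ℝ), mul_div_mul_left _ _ p₂.ne', div_eq_mul_inv]
    gcongr
  · by_cases h : R₁ < R₂
    · rw [if_pos h, if_pos h, ratio, mul_div_mul_left _ _ p₁.ne']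
      gcongr
    · rw [if_neg h, if_neg h, zero_div]
  · by_cases h : R₂ < R₁
    · rw [if_pos h, if_pos h, ratio, mul_div_mul_right _ _ p₂.ne']
      gcongr
    · rw [if_neg h, if_neg h, zero_div]

end Linear

/-! ### Achievability by random linear codes -/

section LinearCodes

variable {F X₁ X₂ Y : Type*} [Field F] [Fintype F] [Fintype Y]

theorem expect_linearError_eq (W : X₁ → X₂ → PMF Y) (φ₁ : F → X₁) (φ₂ : F → X₂) {k₁ k₂ n : ℕ}
    (dec : (Fin n → Fin (max k₁ k₂) → F) → (Fin n → Y) → (Fin k₁ → F) × (Fin k₂ → F)) :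
    𝔼 G : Matrix (Fin (max k₁ k₂)) (Fin n) F, cosetError W φ₁ φ₂ G 0 0 (dec fun i j => G j i) =
    𝔼 g : Fin n → Fin (max k₁ k₂) → F,
      imageError (pairChannel (virtualChannel W φ₁ φ₂))
        (pairMap (padFunctional (max k₁ k₂)) (padFunctional (max k₁ k₂))) g (dec g) := by
  refine Fintype.expect_equiv (Equiv.piComm fun _ _ => F) _ _ fun G => ?_
  refine sum_error_eq W φ₁ φ₂ G 0 0 _ _ _ _
    (fun m i => (padFunctional_apply m _).trans (add_zero _).symm)
    fun m i => (padFunctional_apply m _).trans (add_zero _).symm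

theorem achievableByRandomLinearCodes_of_mem (W : X₁ → X₂ → PMF Y) (φ₁ : F → X₁) (φ₂ : F → X₂)
    (R₁ R₂ : ℝ) (hR₁ : 0 < R₁) (hR₂ : 0 < R₂)
    (hR : (R₁, R₂) ∈
      regionMAC (virtualChannel W φ₁ φ₂) ∩ regionL (virtualChannel W φ₁ φ₂))
    (hA : ¬ HasLinearAmbiguity (virtualChannel W φ₁ φ₂) R₁ R₂) :
    AchievableByRandomLinearCodes W φ₁ φ₂ R₁ R₂ := by
  classical
  have hq : (1 : ℝ) < Fintype.card F := by exact_mod_cast Fintype.one_lt_card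
  have := Fintype.ofFinite (Submodule F (F × F))
  have : Finite (F × F →ₗ[F] F × F) := Finite.of_injective _ DFunLike.coe_injective
  obtain ⟨B, hB, hdec⟩ := exists_vanishing_error hq
    (pairChannel_nonneg (virtualChannel W φ₁ φ₂)) (sum_pairChannel (virtualChannel W φ₁ φ₂))
    {L : Submodule F (F × F) | L ≠ ⊥} (competitorRate R₁ R₂)
    (fun L hL => competitorRate_lt_cosetInfo hR (by simpa using hL))
    (Set.toFinite (competingMaps F R₁ R₂)).toFinset
    (fun A h => exists_ne_of_mem_competingMaps hA (by simpa using h))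
    ((Fintype.card F : ℝ) ^ 3)
  have hdec' := fun n : ℕ => hdec n (Fin (max ⌈n * R₁⌉₊ ⌈n * R₂⌉₊) → F)
    ((Fin ⌈n * R₁⌉₊ → F) × (Fin ⌈n * R₂⌉₊ → F))
    (pairMap (padFunctional _) (padFunctional _))
    (goodPairs R₁ R₂ (padFunctional _) (padFunctional _))
    (fun m hm => hm.1)
    (fun m hm L hL => ncard_competitors_le_rpow (padFunctional_injective (le_max_left _ _))
      (padFunctional_injective (le_max_right _ _)) hR₁.le hR₂.le (by simp) (by simp)
      hm.1 _ (by simpa using hL))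
    -- A type outside the finite set is `⊥`, and then the competitor comes from a competing map.
    (fun m hm m' _ hne => or_iff_not_imp_left.2 fun h => by
      obtain ⟨A, hA, hA'⟩ := exists_mem_competingMaps
        (padFunctional_injective (le_max_left _ _)) (padFunctional_injective (le_max_right _ _))
        (fun a b m m' => ⟨_, padFunctional_smul_add_smul a b m m'⟩)
        (fun a b m m' => ⟨_, padFunctional_smul_add_smul a b m m'⟩) hm hne (by simpa using h)
      exact ⟨A, by simpa using hA, hA'⟩)
  choose dec hdec' using hdec'
  refine ⟨fun n G => dec n fun i j => G j i, ?_⟩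
  have hlim := (tendsto_badFraction hq hR₁ hR₂).add hB
  rw [add_zero] at hlim
  refine squeeze_zero (fun n => Finset.expect_nonneg fun G _ =>
    cosetError_nonneg W φ₁ φ₂ G 0 0 _) (fun n => ?_) hlim
  rw [expect_linearError_eq]
  exact (hdec' n).trans (add_le_add_left (ncard_compl_goodPairs_div_le hR₁.le hR₂.le
    (padFunctional_injective (le_max_left _ _)) (padFunctional_injective (le_max_right _ _))
    (by simp) (by simp)) _)

end LinearCodes

theorem mainTheorem6 {F X₁ X₂ Y : Type*} [Field F] [Fintype F] [Fintype Y]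
    (W : X₁ → X₂ → PMF Y) (φ₁ : F → X₁) (φ₂ : F → X₂) (R₁ R₂ : ℝ) (hR₁ : 0 ≤ R₁) (hR₂ : 0 ≤ R₂)
    (hR : (R₁, R₂) ∈
      regionMAC (virtualChannel W φ₁ φ₂) ∩ regionL (virtualChannel W φ₁ φ₂)) :
    AchievableByRandomCosetCodes W φ₁ φ₂ R₁ R₂ ∧
    (0 < R₁ → 0 < R₂ → ¬ HasLinearAmbiguity (virtualChannel W φ₁ φ₂) R₁ R₂ →
      AchievableByRandomLinearCodes W φ₁ φ₂ R₁ R₂) :=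
  ⟨achievableByRandomCosetCodes_of_mem W φ₁ φ₂ R₁ R₂ hR₁ hR₂ hR, fun h₁ h₂ hA =>
    achievableByRandomLinearCodes_of_mem W φ₁ φ₂ R₁ R₂ h₁ h₂ hR hA⟩
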